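/- A skew brace is a set $B$ with two group structures $(B,+)$ (not necessarily commutative) and $(B,\circ)$ such that $a\circ(b+c)=a\circ b-a+a\circ c$ for all $a,b,c\in B$; put $a\ast b=-a+a\circ b-b$. A skew sub-brace is a subset that is a subgroup for both structures. For a skew sub-brace $C$ put $C_{(1)}=C$ and let $C_{(n+1)}$ be the additive subgroup generated by $\{a\ast b: a,b\in C_{(n)}\}$; $C$ is weakly soluble of derived length $k\ge 0$ if $k$ is least with $C_{(k+1)}=\{0\}$. Formulas are first-order formulas in the language $\{+,\circ,{}^{-1},-,0\}$, and definable means definable by a formula with parameters. For an infinite cardinal $\kappa$, $B$ is $\kappa$-stable if over every model of $\mathrm{Th}(B)$ of cardinality $\kappa$ there are exactly $\kappa$ complete types in finitely many variables; $B$ is stable if it is $\kappa$-stable for some infinite $\kappa$, and $\omega$-stable if it is $\aleph_0$-stable. For $X\subseteq B$ let $\overline X^+$ (respectively $\overline X^\circ$) be the intersection of all definable additive (respectively multiplicative) subgroups of $B$ containing $X$. **Theorem.** Let $B$ be a stable skew brace and $C$ a weakly soluble skew sub-brace of $B$ of derived length $k$. Then: 1. For all $n\ge 1$, $\overline{C_{(n)}}^+=\overline{C_{(n)}}^\circ=:\overline{C_{(n)}}$,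 and this is a skew sub-brace of $B$. In particular $\overline C^+=\overline C^\circ=:\overline C$. 2. $\overline C$ is weakly soluble of derived length $k$. 3. $\overline C$ is type-definable, in the sense that is preserved in elementary extensions: there is a set $\pi(x)$ of formulas with parameters in $B$ such that the set of realizations of $\pi$ in $B$ is $\overline C$ and, for every elementary extension $B'$ of $B$, the set of realizations of $\pi$ in $B'$ is equal to both the additive and the multiplicative definable hull of $C$ in $B'$, and is a weakly soluble skew sub-brace of $B'$ of derived length $k$. 4. $\overline{C_{(n)}}\ast\overline{C_{(n)}}\subseteq\overline{C_{(n+1)}}$ for all $n\ge 1$, where $X\ast Y=\{x\ast y:x\in X,\ y\in Y\}$. 5. If $B$ is $\omega$-stable, then $\overline C$ and all $\overline{C_{(n)}}$ ($n\ge 1$) are definable. -/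

import Mathlib

open FirstOrder Cardinal

universe u v

/-! ### Skew braces -/

/-- A skew (left) brace, written with `+` for the (not necessarily commutative) additive group and
with `*` for the multiplicative group (the circle operation). -/
class SkewBrace (B : Type u) extends AddGroup B, Group B where
  /-- The skew left distributive law. -/
  skew_left_distrib : ∀ a b c : B, a * (b + c) = a * b - a + a * c

namespace SkewBrace

/-- The third operation `a ∗ b = -a + a ∘ b - b` of a skew brace. -/
def star {B : Type u} [SkewBrace B] (a b : B) : B := -a + a * b - b

end SkewBrace

/-- A skew sub-brace: a subset that is a subgroup for both group structures. -/
structure SkewSubbrace (B : Type u) [SkewBrace B] extends AddSubgroup B, Subgroup B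

namespace SkewSubbrace

variable {B : Type u} [SkewBrace B]

instance : CoeOut (SkewSubbrace B) (Set B) := ⟨fun C => C.carrier⟩

/-- The derived series of a skew sub-brace `C`, indexed from `0`: `C.derived n` is the term usually
written `C_(n+1)`. So `C.derived 0 = C_(1) = C`, and `C.derived (n + 1) = C_(n+2)` is the additive
subgroup generated by all `a ∗ b` with `a, b ∈ C_(n+1)`. -/
def derived (C : SkewSubbrace B) : ℕ → AddSubgroup B
  | 0 => C.toAddSubgroup
  | n + 1 => AddSubgroup.closure
      {x | ∃ a ∈ C.derived n, ∃ b ∈ C.derived n, x = SkewBrace.star a b}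

/-- `C` is weakly soluble of derived length `k`: `C_(k+1) = {0}`, and no earlier term vanishes. -/
def IsWeaklySolubleOfLength (C : SkewSubbrace B) (k : ℕ) : Prop :=
  C.derived k = ⊥ ∧ ∀ m < k, C.derived m ≠ ⊥

end SkewSubbrace

/-! ### The first-order language of skew braces -/

namespace SkewBrace

/-- The function symbols of the language of skew braces, by arity. -/
inductive LangFunc : ℕ → Type
  | zero : LangFunc 0
  | neg : LangFunc 1
  | inv : LangFunc 1
  | add : LangFunc 2
  | mul : LangFunc 2

/-- The language `{+, ∘, ⁻¹, -, 0}` of skew braces. -/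
def Lang : FirstOrder.Language.{0, 0} := ⟨LangFunc, fun _ => Empty⟩

/-- Interpretation of the function symbols in a skew brace. -/
def funInterp (B : Type u) [SkewBrace B] : {n : ℕ} → LangFunc n → (Fin n → B) → B
  | _, .zero, _ => 0
  | _, .neg, x => -x 0
  | _, .inv, x => (x 0)⁻¹
  | _, .add, x => x 0 + x 1
  | _, .mul, x => x 0 * x 1

instance instLangStructure (B : Type u) [SkewBrace B] : Lang.Structure B where
  funMap := fun f x => funInterp B f x
  RelMap := fun r _ => r.elim

/-! ### Stability -/

/-- `B` is `κ`-stable: every model `A` of `Th(B)` of cardinality `κ` has exactly `κ` complete types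
(in finitely many variables) over `A`. -/
def IsStableIn (B : Type u) [SkewBrace B] (κ : Cardinal.{u}) : Prop :=
  ∀ (A : Type u) [Lang.Structure A], A ⊨ Lang.completeTheory B → #A = κ →
    #(Σ n : ℕ, (Lang.elementaryDiagram A).CompleteType (Fin n)) = κ

/-- `B` is stable: `κ`-stable for some infinite cardinal `κ`. -/
def IsStable (B : Type u) [SkewBrace B] : Prop :=
  ∃ κ : Cardinal.{u}, ℵ₀ ≤ κ ∧ IsStableIn B κ

/-- `B` is `ω`-stable. -/
def IsOmegaStable (B : Type u) [SkewBrace B] : Prop :=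
  IsStableIn B ℵ₀

/-! ### Definable sets, hulls and partial types -/

/-- A subset of `B` is definable: by a formula of the language of skew braces with parameters
in `B`. -/
def IsDefinable {B : Type u} [SkewBrace B] (X : Set B) : Prop :=
  (Set.univ : Set B).Definable₁ Lang X

/-- The additive definable hull: the intersection of all definable additive subgroups of `B`
containing `X`. -/
def addHull {B : Type u} [SkewBrace B] (X : Set B) : AddSubgroup B :=
  sInf {H | IsDefinable (H : Set B) ∧ X ⊆ H}

/-- The multiplicative definable hull: the intersection of all definable multiplicative subgroups
of `B` containing `X`. -/
def mulHull {B : Type u} [SkewBrace B] (X : Set B) : Subgroup B :=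
  sInf {H | IsDefinable (H : Set B) ∧ X ⊆ H}

/-- The set defined in an elementary extension `f : B ↪ₑ B'` by a collection `π` of formulas in one
variable with parameters in `B`. -/
def realizations {B : Type u} {B' : Type v} [SkewBrace B] [SkewBrace B']
    (π : Set (Lang.Formula (B ⊕ Unit))) (f : B ↪ₑ[Lang] B') : Set B' :=
  {x | ∀ φ ∈ π, φ.Realize (Sum.elim f fun _ => x)}

end SkewBrace

namespace FirstOrder.Language

/-- The set of elements satisfying `φ` with parameters `y`. -/
def Formula.fiber {L : Language.{0, 0}} {M : Type*} [L.Structure M] {β : Type*}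
    (φ : L.Formula (β ⊕ Unit)) (y : β → M) : Set M :=
  {x | φ.Realize (Sum.elim y fun _ => x)}

@[simp]
theorem Formula.mem_fiber {L : Language.{0, 0}} {M : Type*} [L.Structure M] {β : Type*}
    {φ : L.Formula (β ⊕ Unit)} {y : β → M} {x : M} :
    x ∈ φ.fiber y ↔ φ.Realize (Sum.elim y fun _ => x) := Iff.rfl

/-- Pairwise separated families of definable sets with the finite intersection property extend to
distinct complete types. -/
theorem card_le_card_completeType {L : Language.{0, 0}} {A : Type u} [L.Structure A] [Nonempty A]
    {I : Type v} (𝒟 : I → Set (Set A))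
    (hdef : ∀ i, ∀ X ∈ 𝒟 i, ∃ φ : L.Formula (A ⊕ Unit), φ.fiber id = X)
    (fip : ∀ i, ∀ s : Set (Set A), s ⊆ 𝒟 i → s.Finite → (⋂₀ s).Nonempty)
    (sep : ∀ i j, i ≠ j → ∃ X ∈ 𝒟 i, ∃ Y ∈ 𝒟 j, Disjoint X Y) :
    lift.{u} #I ≤ lift.{v} #(Σ n : ℕ, (L.elementaryDiagram A).CompleteType (Fin n)) := by
  classical
  have hU : ∀ i, ∃ U : Ultrafilter A, 𝒟 i ⊆ (U : Filter A).sets := by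
    intro i
    have : (Filter.generate (𝒟 i)).NeBot := by
      rw [Filter.generate_neBot_iff]
      exact fun t ht hf => fip i t ht hf
    exact ⟨Ultrafilter.of (Filter.generate (𝒟 i)), fun X hX =>
      Ultrafilter.of_le (Filter.generate (𝒟 i)) (Filter.mem_generate_of_mem hX)⟩
  choose U hU using hU
  have key : ∀ i, ∃ p : (L.elementaryDiagram A).CompleteType (Fin 1),
      ∀ φ : L[[A]].Formula (Fin 1), Formula.equivSentence φ ∈ p ↔
        ∀ᶠ a in (U i : Filter A), φ.Realize fun _ => a := by
    intro i
    let _ : L[[A]].Structure ((U i : Filter A).Product fun _ => A) := Ultraproduct.structure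
    have hne : Nonempty ((U i : Filter A).Product fun _ => A) :=
      Ultraproduct.Product.instNonempty (M := fun _ : A => A)
    have : ((U i : Filter A).Product fun _ => A) ⊨ L.elementaryDiagram A := by
      refine ⟨fun φ hφ => ?_⟩
      rw [Ultraproduct.sentence_realize]
      exact Filter.Eventually.of_forall fun _ => hφ
    refine ⟨(L.elementaryDiagram A).typeOf (M := (U i : Filter A).Product fun _ => A)
      (fun _ => ((fun a => a : ∀ _ : A, A) : (U i : Filter A).Product fun _ => A)), fun φ => ?_⟩
    exact Theory.CompleteType.formula_mem_typeOf.trans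
      (Ultraproduct.realize_formula_cast φ fun _ => fun a => a)
  choose p hp using key
  rw [Cardinal.lift_mk_le']
  refine ⟨⟨fun i => ⟨1, p i⟩, fun i j hij => ?_⟩⟩
  by_contra hne
  have hpp : p i = p j := by simpa using hij
  obtain ⟨X, hX, Y, hY, hd⟩ := sep i j hne
  obtain ⟨φ, hφ⟩ := hdef i X hX
  let ψ : L[[A]].Formula (Fin 1) :=
    BoundedFormula.constantsVarsEquiv.symm (φ.relabel (Sum.map id fun _ => (0 : Fin 1)))
  have hψ : ∀ a : A, ψ.Realize (fun _ => a) ↔ a ∈ X := by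
    intro a
    have e : BoundedFormula.constantsVarsEquiv ψ = φ.relabel (Sum.map id fun _ => (0 : Fin 1)) :=
      _root_.Equiv.apply_symm_apply _ _
    rw [← hφ, Formula.mem_fiber, Formula.Realize, ← BoundedFormula.realize_constantsVarsEquiv, e]
    change Formula.Realize _ _ ↔ _
    rw [Formula.realize_relabel]
    refine iff_of_eq (congrArg _ ?_)
    ext x
    rcases x with x | x <;> rfl
  have h1 : Formula.equivSentence ψ ∈ p i := by
    rw [hp]
    simp only [hψ]
    exact hU i hX
  rw [hpp, hp] at h1
  simp only [hψ] at h1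
  have h2 : Y ∈ (U j : Filter A) := hU j hY
  have h3 := Filter.inter_mem h1 h2
  rw [show {a | a ∈ X} ∩ Y = ∅ from hd.inter_eq] at h3
  exact Filter.empty_notMem _ h3

end FirstOrder.Language

theorem Cardinal.exists_linearOrder_dense {κ : Cardinal.{u}} (hκ : ℵ₀ ≤ κ) :
    ∃ (I : Type u) (_ : LinearOrder I) (D : Set I), #D ≤ κ ∧ κ < #I ∧
      (∀ f g : I, f < g → ∃ d ∈ D, f < d ∧ d ≤ g) ∧ ∃ d ∈ D, ∀ g, d ≤ g := by
  classical
  have hex : ∃ μ : Cardinal.{u}, κ < 2 ^ μ := ⟨κ, Cardinal.cantor κ⟩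
  let μ := WellFounded.min Cardinal.lt_wf {μ : Cardinal.{u} | κ < 2 ^ μ} hex
  have hμ : κ < 2 ^ μ := WellFounded.min_mem Cardinal.lt_wf _ hex
  have hmin : ∀ ν < μ, (2 : Cardinal.{u}) ^ ν ≤ κ := fun ν hν => not_lt.1 fun h =>
    WellFounded.not_lt_min Cardinal.lt_wf {μ : Cardinal.{u} | κ < 2 ^ μ} h hν
  have hμκ : μ ≤ κ := not_lt.1 fun h => (hmin κ h).not_gt (Cardinal.cantor κ)
  have hμ0 : ℵ₀ ≤ μ := by
    by_contra h
    rw [not_le] at h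
    exact (hμ.trans (Cardinal.power_lt_aleph0 (Cardinal.natCast_lt_aleph0 (n := 2)) h)).not_ge hκ
  let W := μ.ord.ToType
  have hW : #W = μ := by simp [W]
  have : Nonempty W := by
    rw [← Cardinal.mk_ne_zero_iff, hW]
    exact (Cardinal.aleph0_pos.trans_le hμ0).ne'
  let I := Lex (W → Fin 2)
  let D : Set I := ⋃ a : W, {f | ∀ b, a < b → ofLex f b = 0}
  refine ⟨I, inferInstance, D, ?_, ?_, ?_, ?_⟩
  · refine (Cardinal.mk_iUnion_le_sum_mk).trans ?_
    refine (Cardinal.sum_le_sum _ (fun _ => κ) fun a => ?_).trans ?_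
    · have hlt : #(Set.Iic a) < μ := by
        rw [← Set.Iio_insert]
        refine (Cardinal.mk_insert_le).trans_lt ?_
        exact Cardinal.add_lt_of_lt hμ0 ((Cardinal.mk_Iio_lt a (by simp [W])).trans_eq hW)
          (Cardinal.one_lt_aleph0.trans_le hμ0)
      refine le_trans ?_ (hmin _ hlt)
      have : #({f : I | ∀ b, a < b → ofLex f b = 0}) ≤ #(Set.Iic a → Fin 2) := by
        refine Cardinal.mk_le_of_injective (f := fun f b => ofLex f.1 b.1) ?_
        rintro ⟨f, hf⟩ ⟨g, hg⟩ hfg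
        ext1
        refine ofLex.injective (funext fun b => ?_)
        rcases le_or_gt b a with h | h
        · exact congrFun hfg ⟨b, h⟩
        · exact (hf b h).trans (hg b h).symm
      refine this.trans ?_
      simp
    · rw [Cardinal.sum_const', hW]
      exact (mul_le_mul' hμκ le_rfl).trans (Cardinal.mul_eq_self hκ).le
  · have : #I = 2 ^ μ := by
      change #(W → Fin 2) = _
      simp [hW]
    rwa [this]
  · intro f g hfg
    obtain ⟨a, ha, hlt⟩ := hfg
    have hf0 : ofLex f a = 0 ∧ ofLex g a = 1 := by
      change ofLex f a < ofLex g a at hlt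
      omega
    refine ⟨toLex fun b => if b ≤ a then ofLex g b else 0, ?_, ?_, ?_⟩
    · exact Set.mem_iUnion.2 ⟨a, fun b hb => if_neg hb.not_ge⟩
    · refine ⟨a, fun j hj => ?_, ?_⟩
      · exact (ha j hj).trans (if_pos hj.le).symm
      · exact hlt.trans_eq (if_pos le_rfl).symm
    · refine Pi.toLex_monotone (a := fun b => if b ≤ a then ofLex g b else 0) (b := ofLex g) ?_
      intro b
      dsimp only
      split_ifs
      · exact le_rfl
      · exact Fin.zero_le _
  · refine ⟨toLex fun _ => 0, Set.mem_iUnion.2 ⟨Classical.arbitrary W, fun _ _ => rfl⟩, fun g => ?_⟩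
    exact Pi.toLex_monotone (a := fun _ => 0) (b := ofLex g) fun b => Fin.zero_le _

namespace FirstOrder.Language

/-- Arbitrarily long finite sequences ordered by `φ` give one indexed by any linear order, in an
elementarily equivalent structure. -/
theorem exists_ordered_of_forall {L : Language.{0, 0}} {B : Type u} [L.Structure B] {m : ℕ}
    (φ : L.Formula (Fin m ⊕ Unit))
    (h : ∀ N, ∃ (x : ℕ → B) (y : ℕ → Fin m → B),
      ∀ i < N, ∀ j < N, (x i ∈ φ.fiber (y j) ↔ j ≤ i))
    (D : Type u) [LinearOrder D] :
    ∃ (M : Type u) (_ : L.Structure M), (B ≅[L] M) ∧ ∃ (x : D → M) (y : D → Fin m → M),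
      ∀ d e, x d ∈ φ.fiber (y e) ↔ e ≤ d := by
  classical
  choose X Y hXY using h
  have : Nonempty B := ⟨X 0 0⟩
  let U : Ultrafilter (Finset D) := Ultrafilter.of Filter.atTop
  let r : Finset D → D → ℕ := fun s d => (s.filter (· < d)).card
  have hr : ∀ s : Finset D, ∀ d ∈ s, r s d < s.card := fun s d hd =>
    Finset.card_lt_card (Finset.filter_ssubset.2 ⟨d, hd, lt_irrefl _⟩)
  have hr' : ∀ s : Finset D, ∀ d ∈ s, ∀ e ∈ s, (r s e ≤ r s d ↔ e ≤ d) := by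
    intro s d hd e he
    constructor
    · intro hle
      by_contra! hlt
      refine (Finset.card_lt_card (s := s.filter (· < d)) (t := s.filter (· < e)) ?_).not_ge hle
      refine (Finset.ssubset_iff_of_subset ?_).2 ⟨d, by simp [hd, hlt], by simp⟩
      exact Finset.monotone_filter_right _ fun a _ (ha : a < d) => ha.trans hlt
    · intro hle
      exact Finset.card_le_card
        (Finset.monotone_filter_right _ fun a _ (ha : a < e) => ha.trans_le hle)
  let M := (U : Filter (Finset D)).Product fun _ => B
  let cast : (Finset D → B) → M := fun f => (f : (U : Filter (Finset D)).Product fun _ => B)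
  refine ⟨M, inferInstanceAs (L.Structure ((U : Filter (Finset D)).Product fun _ => B)), ?_,
    fun d => cast fun s => X s.card (r s d), fun d k => cast fun s => Y s.card (r s d) k, ?_⟩
  · rw [elementarilyEquivalent_iff]
    intro ψ
    refine (Iff.trans (Ultraproduct.sentence_realize ψ) ?_).symm
    simp
  · intro d e
    have key := Ultraproduct.realize_formula_cast (u := U) (M := fun _ => B) φ
      (Sum.elim (fun k s => Y s.card (r s e) k) (fun _ s => X s.card (r s d)))
    rw [Formula.mem_fiber]
    have e1 : (Sum.elim (fun k => cast fun s => Y s.card (r s e) k)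
        (fun _ : Unit => cast fun s => X s.card (r s d)) : Fin m ⊕ Unit → M) =
        fun i => cast (Sum.elim (fun k s => Y s.card (r s e) k)
          (fun _ s => X s.card (r s d)) i) := by
      ext i
      rcases i with i | i <;> rfl
    have hev : ∀ᶠ s in (U : Filter (Finset D)), d ∈ s ∧ e ∈ s := by
      refine Ultrafilter.of_le Filter.atTop ?_
      filter_upwards [Filter.eventually_ge_atTop ({d, e} : Finset D)] with s hs
      exact ⟨hs (by simp), hs (by simp)⟩
    have e2 : ∀ᶠ s in (U : Filter (Finset D)),
        (φ.Realize (fun i => Sum.elim (fun k s => Y s.card (r s e) k)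
          (fun _ s => X s.card (r s d)) i s) ↔ e ≤ d) := by
      filter_upwards [hev] with s hs
      rw [← hr' s d hs.1 e hs.2, ← hXY s.card _ (hr s d hs.1) _ (hr s e hs.2), Formula.mem_fiber]
      refine iff_of_eq (congrArg _ ?_)
      ext i
      rcases i with i | i <;> rfl
    rw [e1]
    refine key.trans ((Filter.eventually_congr e2).trans ?_)
    simp

/-- The realizations of an ordered sequence can be kept in a model of prescribed cardinality. -/
theorem exists_ordered_card_eq {L : Language.{0, 0}} (hL : L.card ≤ ℵ₀) {M : Type u}
    [L.Structure M] [Infinite M] {m : ℕ} (φ : L.Formula (Fin m ⊕ Unit)) {κ : Cardinal.{u}}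
    (hκ : ℵ₀ ≤ κ) {D : Type u} (hD : #D ≤ κ) [LinearOrder D] (x : D → M) (y : D → Fin m → M)
    (h : ∀ d e, x d ∈ φ.fiber (y e) ↔ e ≤ d) :
    ∃ (A : Type u) (_ : L.Structure A), (M ≅[L] A) ∧ #A = κ ∧
      ∃ (x : D → A) (y : D → Fin m → A), ∀ d e, x d ∈ φ.fiber (y e) ↔ e ≤ d := by
  let Γ := D ⊕ D × Fin m
  let _ : (constantsOn Γ).Structure M :=
    constantsOn.structure (Sum.elim x fun p => y p.1 p.2)
  have hΓ : #Γ ≤ κ := by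
    simp only [Γ, mk_sum, mk_prod, lift_id, mk_fin, lift_natCast, lift_uzero]
    refine add_le_of_le hκ hD ?_
    exact mul_le_of_le hκ hD ((natCast_lt_aleph0).le.trans hκ)
  have hcard : lift.{u} L[[Γ]].card ≤ lift.{u} κ := by
    rw [lift_le, card_withConstants]
    refine add_le_of_le hκ ?_ (by simpa using hΓ)
    exact (lift_le_aleph0.2 hL).trans hκ
  obtain ⟨N, hMN, hN⟩ := exists_elementarilyEquivalent_card_eq L[[Γ]] M κ hκ (by simpa using hcard)
  let _ : L.Structure N := (lhomWithConstants L Γ).reduct N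
  have hexp : (lhomWithConstants L Γ).IsExpansionOn N := LHom.isExpansionOn_reduct _ _
  refine ⟨N, inferInstance, ?_, hN, fun d => (L.con (Sum.inl d : Γ) : N),
    fun d k => (L.con (Sum.inr (d, k) : Γ) : N), ?_⟩
  · rw [elementarilyEquivalent_iff] at hMN ⊢
    intro ψ
    rw [← (lhomWithConstants L Γ).realize_onSentence M, hMN,
      (lhomWithConstants L Γ).realize_onSentence N]
  · intro d e
    rw [← h d e]
    let ψ : L.Formula Γ := φ.relabel (Sum.elim (fun k => Sum.inr (e, k)) fun _ => Sum.inl d)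
    have h1 := Formula.realize_equivSentence M ψ
    have h2 := Formula.realize_equivSentence N ψ
    have h3 := (elementarilyEquivalent_iff.1 hMN (Formula.equivSentence ψ))
    rw [h1, h2] at h3
    simp only [ψ, Formula.realize_relabel] at h3
    rw [Formula.mem_fiber, Formula.mem_fiber]
    refine Iff.trans (iff_of_eq (congrArg _ ?_)) (h3.symm.trans (iff_of_eq (congrArg _ ?_)))
    · ext i
      rcases i with i | i <;> rfl
    · ext i
      rcases i with i | i <;> rfl

/-- In a theory with few types over its models of cardinality `κ`, no formula orders arbitrarily
long sequences. -/
theorem exists_forall_not_ordered {L : Language.{0, 0}} (hL : L.card ≤ ℵ₀) {B : Type u}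
    [L.Structure B] {κ : Cardinal.{u}} (hκ : ℵ₀ ≤ κ)
    (hst : ∀ (A : Type u) [L.Structure A], A ⊨ L.completeTheory B → #A = κ →
      #(Σ n : ℕ, (L.elementaryDiagram A).CompleteType (Fin n)) ≤ κ) {m : ℕ}
    (φ : L.Formula (Fin m ⊕ Unit)) :
    ∃ N, ∀ (x : ℕ → B) (y : ℕ → Fin m → B),
      ¬ ∀ i < N, ∀ j < N, (x i ∈ φ.fiber (y j) ↔ j ≤ i) := by
  classical
  by_contra! hno
  have hBinf : Infinite B := by
    by_contra hfin
    rw [not_infinite_iff_finite] at hfin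
    obtain ⟨x, y, hxy⟩ := hno (Nat.card B + 1)
    have hinj : Function.Injective fun i : Fin (Nat.card B + 1) => x i := by
      intro i j hij
      have h1 := (hxy i i.2 j j.2)
      have h2 := (hxy j j.2 i i.2)
      have h3 := (hxy i i.2 i i.2)
      have h4 := (hxy j j.2 j j.2)
      simp only at hij
      rw [hij] at h1 h3
      ext
      have := h1.1 (h4.2 le_rfl)
      have := h2.1 (h3.2 le_rfl)
      omega
    have := Nat.card_le_card_of_injective _ hinj
    simp at this
  obtain ⟨I, _, D, hD, hI, hdense, d₀, hd₀, hbot⟩ := Cardinal.exists_linearOrder_dense hκ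
  obtain ⟨M, _, hBM, x, y, hxy⟩ := exists_ordered_of_forall φ hno D
  have hMinf : Infinite M := hBM.infinite_iff.1 hBinf
  obtain ⟨A, _, hMA, hA, x, y, hxy⟩ := exists_ordered_card_eq hL φ hκ hD x y hxy
  have hAB : A ⊨ L.completeTheory B := (hBM.trans hMA).theory_model
  have : Nonempty A := ⟨x ⟨d₀, hd₀⟩⟩
  refine (hI.trans_le ?_).not_ge (hst A hAB hA)
  let 𝒟 : I → Set (Set A) := fun g =>
    {X | ∃ d : D, d.1 ≤ g ∧ X = φ.fiber (y d)} ∪ {X | ∃ d : D, g < d.1 ∧ X = (φ.fiber (y d))ᶜ}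
  have key := card_le_card_completeType (L := L) 𝒟 ?_ ?_ ?_
  · simpa using key
  · rintro g X (⟨d, -, rfl⟩ | ⟨d, -, rfl⟩)
    · refine ⟨φ.relabel (Sum.map (y d) id), ?_⟩
      ext a
      rw [Formula.mem_fiber, Formula.mem_fiber, Formula.realize_relabel]
      refine iff_of_eq (congrArg _ ?_)
      ext i
      rcases i with i | i <;> rfl
    · refine ⟨(φ.relabel (Sum.map (y d) id)).not, ?_⟩
      ext a
      rw [Formula.mem_fiber, Set.mem_compl_iff, Formula.mem_fiber, Formula.realize_not,
        Formula.realize_relabel]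
      refine not_congr (iff_of_eq (congrArg _ ?_))
      ext i
      rcases i with i | i <;> rfl
  · intro g s hs hfin
    have hE : ∃ e : D, e.1 ≤ g ∧ ∀ X ∈ s, ∀ d : D, d.1 ≤ g → X = φ.fiber (y d) → d ≤ e := by
      have : ∀ X ∈ s, ∃ e : D, e.1 ≤ g ∧ ∀ d : D, d.1 ≤ g → X = φ.fiber (y d) → d ≤ e := by
        intro X _
        by_cases hX : ∃ d : D, d.1 ≤ g ∧ X = φ.fiber (y d)
        · obtain ⟨d, hd, rfl⟩ := hX
          refine ⟨d, hd, fun d' _ h => ?_⟩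
          rw [← hxy d d', ← h, hxy]
        · exact ⟨⟨d₀, hd₀⟩, hbot g, fun d h h' => (hX ⟨d, h, h'⟩).elim⟩
      have : Nonempty D := ⟨⟨d₀, hd₀⟩⟩
      choose! e he1 he2 using ‹∀ X ∈ s, _›
      rcases s.eq_empty_or_nonempty with rfl | hne
      · exact ⟨⟨d₀, hd₀⟩, hbot g, by simp⟩
      · obtain ⟨X, hX, hmax⟩ := Set.exists_max_image s e hfin hne
        exact ⟨e X, he1 X hX, fun X' hX' d hd h => (he2 X' hX' d hd h).trans (hmax X' hX')⟩
    obtain ⟨e, he, hmax⟩ := hE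
    refine ⟨x e, fun X hX => ?_⟩
    rcases hs hX with ⟨d, hd, h⟩ | ⟨d, hd, rfl⟩
    · rw [h, hxy]
      exact hmax X hX d hd h
    · rw [Set.mem_compl_iff, hxy, not_le]
      exact he.trans_lt hd
  · have aux : ∀ f g : I, f < g → ∃ X ∈ 𝒟 f, ∃ Y ∈ 𝒟 g, Disjoint X Y := by
      intro f g hfg
      obtain ⟨d, hd, h1, h2⟩ := hdense f g hfg
      exact ⟨_, Or.inr ⟨⟨d, hd⟩, h1, rfl⟩, _, Or.inl ⟨⟨d, hd⟩, h2, rfl⟩, disjoint_compl_left⟩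
    intro f g hfg
    rcases lt_or_gt_of_ne hfg with h | h
    · exact aux f g h
    · obtain ⟨X, hX, Y, hY, hd⟩ := aux g f h
      exact ⟨Y, hY, X, hX, hd.symm⟩

end FirstOrder.Language

/-- `b` picks the first `n` members of a strictly descending chain of finite intersections of
members of the family `S`. -/
def IsIntersectionChain {G Y : Type*} (S : Y → Set G) (b : ℕ → Y) (n : ℕ) : Prop :=
  ∀ j < n, ∃ x, (∀ i < j, x ∈ S (b i)) ∧ x ∉ S (b j)

/-- A family of subgroups omitting an order pattern has no long independent subfamilies. -/
theorem not_independent_of_not_ordered {G Y : Type*} [AddGroup G] {S : Y → Set G} {N : ℕ}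
    (hN : ∀ (x : ℕ → G) (y : ℕ → Y), ¬ ∀ i < N, ∀ j < N, (x i ∈ S (y j) ↔ j ≤ i))
    (b : ℕ → Y) (hb : ∀ i < N, ∃ H : AddSubgroup G, (H : Set G) = S (b i)) (x : ℕ → G) :
    ¬ ∀ i < N, ∀ j < N, (x i ∈ S (b j) ↔ i ≠ j) := by
  intro h
  let w : ℕ → G := fun k => Nat.rec 0 (fun k z => x k + z) k
  have hw : ∀ j < N, ∀ k ≤ N, (w k ∈ S (b j) ↔ k ≤ j) := by
    intro j hj
    obtain ⟨H, hH⟩ := hb j hj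
    have hmem : ∀ z, z ∈ S (b j) ↔ z ∈ H := fun z => by rw [← hH]; rfl
    intro k
    induction k with
    | zero =>
      intro _
      simp [w, hmem, H.zero_mem]
    | succ k ih =>
      intro hk
      have hih := ih (by omega)
      have hx := h k (by omega) j hj
      change x k + w k ∈ S (b j) ↔ _
      rw [hmem] at hih hx ⊢
      rcases lt_trichotomy k j with hkj | rfl | hkj
      · exact ⟨fun _ => hkj, fun _ => H.add_mem (hx.2 hkj.ne) (hih.2 hkj.le)⟩
      · refine ⟨fun hs => ?_, fun hs => by omega⟩
        rw [H.add_mem_cancel_right (hih.2 le_rfl)] at hs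
        exact (hx.1 hs rfl).elim
      · refine ⟨fun hs => ?_, fun hs => by omega⟩
        rw [H.add_mem_cancel_left (hx.2 hkj.ne')] at hs
        exact (hih.1 hs).not_gt hkj |>.elim
  refine hN (fun i => w (N - 1 - i)) (fun j => b (N - 1 - j)) fun i hi j hj => ?_
  rw [hw _ (by omega) _ (by omega)]
  omega

/-- The Baldwin–Saxl argument: a finite intersection from a family without long independent
subfamilies is an intersection of boundedly many members, so a family whose bounded intersections
omit an order pattern has no long chains of intersections. -/
theorem not_isIntersectionChain_of_not_ordered {G Y : Type*} {S : Y → Set G} {T : Set Y} {n N : ℕ}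
    (hn : ∀ b : ℕ → Y, (∀ i < n, b i ∈ T) → ∀ x : ℕ → G,
      ¬ ∀ i < n, ∀ j < n, (x i ∈ S (b j) ↔ i ≠ j))
    (hN : ∀ (x : ℕ → G) (y : ℕ → Fin n → Y),
      ¬ ∀ i < N, ∀ j < N, ((∀ k, x i ∈ S (y j k)) ↔ j ≤ i))
    (b : ℕ → Y) (hb : ∀ i < N + 1, b i ∈ T) : ¬ IsIntersectionChain S b (N + 1) := by
  classical
  intro hch
  have : Nonempty G := ⟨(hch 0 N.succ_pos).choose⟩
  have : Nonempty Y := ⟨b 0⟩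
  choose! x hx1 hx2 using hch
  have hsub : ∀ j < N, ∃ c : Fin n → Y, ∀ z, (∀ k, z ∈ S (c k)) ↔ ∀ i ≤ j, z ∈ S (b i) := by
    intro j hj
    let good : Finset ℕ → Prop := fun s =>
      s ⊆ Finset.range (j + 1) ∧ ∀ z, (∀ i ∈ s, z ∈ S (b i)) → ∀ i ≤ j, z ∈ S (b i)
    have hex : ∃ l, ∃ s, good s ∧ s.card = l :=
      ⟨_, Finset.range (j + 1), ⟨subset_rfl, fun z hz i hi => hz i (by simp; omega)⟩, rfl⟩
    obtain ⟨s, hs, hcard⟩ := Nat.find_spec hex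
    have hmin : ∀ i ∈ s, ∃ z, (∀ k ∈ s, k ≠ i → z ∈ S (b k)) ∧ z ∉ S (b i) := by
      intro i hi
      by_contra! hcon
      refine Nat.find_min hex (m := (s.erase i).card) ?_ ⟨s.erase i, ⟨?_, ?_⟩, rfl⟩
      · rw [← hcard]
        exact Finset.card_erase_lt_of_mem hi
      · exact (Finset.erase_subset _ _).trans hs.1
      · intro z hz
        refine hs.2 z fun k hk => ?_
        rcases eq_or_ne k i with rfl | hne
        · exact hcon z fun k' hk' hne => hz k' (Finset.mem_erase.2 ⟨hne, hk'⟩)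
        · exact hz k (Finset.mem_erase.2 ⟨hne, hk⟩)
    choose! z hz1 hz2 using hmin
    have hlt : s.card < n := by
      by_contra! hle
      obtain ⟨e⟩ : Nonempty (Fin n ↪ s) := by
        rw [Function.Embedding.nonempty_iff_card_le]
        simpa using hle
      let f : ℕ → ℕ := fun i => if h : i < n then e ⟨i, h⟩ else 0
      have hf : ∀ i < n, f i ∈ s := fun i hi => by simp [f, hi]
      have hfinj : ∀ i < n, ∀ k < n, i ≠ k → f i ≠ f k := by
        intro i hi k hk hik h
        simp only [f, hi, hk, dif_pos] at h
        exact hik (by simpa using e.injective (Subtype.ext h))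
      refine hn (fun i => b (f i)) (fun i hi => hb _ ?_) (fun i => z (f i)) fun i hi k hk => ?_
      · have := Finset.mem_range.1 (hs.1 (hf i hi))
        omega
      · rcases eq_or_ne i k with rfl | hik
        · simpa using hz2 _ (hf i hi)
        · simpa [hik] using hz1 _ (hf i hi) _ (hf k hk) (hfinj i hi k hk hik).symm
    have hne : s.Nonempty := by
      rw [Finset.nonempty_iff_ne_empty]
      rintro rfl
      exact hx2 0 (by omega) (hs.2 (x 0) (by simp) 0 (by omega))
    have : Nonempty s := hne.to_subtype
    obtain ⟨e⟩ : Nonempty (s ↪ Fin n) := by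
      rw [Function.Embedding.nonempty_iff_card_le]
      simpa using hlt.le
    refine ⟨fun k => b ((Function.invFun (e : s → Fin n) k : s) : ℕ), fun z =>
      ⟨fun h => hs.2 z fun i hi => ?_, fun h k => ?_⟩⟩
    · obtain ⟨k, hk⟩ := Function.invFun_surjective e.injective ⟨i, hi⟩
      have := h k
      simpa only [hk] using this
    · have := Finset.mem_range.1 (hs.1 (Function.invFun (e : s → Fin n) k).2)
      exact h _ (by omega)
  choose! c hc using hsub
  refine hN (fun i => x (i + 1)) c fun i hi j hj => ?_
  rw [hc j hj]
  constructor
  · intro h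
    by_contra! hlt
    exact hx2 (i + 1) (by omega) (h _ hlt)
  · intro h k hk
    exact hx1 (i + 1) (by omega) k (by omega)

/-- If chains of intersections from a family are bounded, then the members containing a set `C`
have a smallest finite intersection, and this is already forced by a finite subset of `C`. -/
theorem exists_finite_intersection_le {G Y : Type*} [Nonempty Y] {S : Y → Set G} {T : Set Y}
    {N : ℕ} (hN : ∀ b : ℕ → Y, (∀ i < N, b i ∈ T) → ¬ IsIntersectionChain S b N) (C : Set G) :
    ∃ C₀ ⊆ C, C₀.Finite ∧ ∃ (n : ℕ) (b : ℕ → Y), (∀ i < n, b i ∈ T) ∧ (∀ i < n, C ⊆ S (b i)) ∧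
      ∀ y ∈ T, C₀ ⊆ S y → ∀ x, (∀ i < n, x ∈ S (b i)) → x ∈ S y := by
  classical
  let chain : Set G → ℕ → Prop := fun C₀ n =>
    ∃ b : ℕ → Y, (∀ i < n, b i ∈ T ∧ C₀ ⊆ S (b i)) ∧ IsIntersectionChain S b n
  have hext : ∀ (C₀ : Set G) (n : ℕ), ¬ chain C₀ (n + 1) → ∀ b : ℕ → Y,
      (∀ i < n, b i ∈ T ∧ C₀ ⊆ S (b i)) → IsIntersectionChain S b n →
      ∀ y ∈ T, C₀ ⊆ S y → ∀ x, (∀ i < n, x ∈ S (b i)) → x ∈ S y := by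
    intro C₀ n hno b hb hch y hy hCy x hx
    by_contra hxy
    refine hno ⟨fun i => if i < n then b i else y, fun i hi => ?_, fun j hj => ?_⟩
    · dsimp only
      split_ifs with h
      · exact hb i h
      · exact ⟨hy, hCy⟩
    · rcases Nat.lt_succ_iff_lt_or_eq.1 hj with h | rfl
      · obtain ⟨z, hz1, hz2⟩ := hch j h
        refine ⟨z, fun i hi => ?_, ?_⟩ <;> dsimp only
        · rw [if_pos (hi.trans h)]
          exact hz1 i hi
        · rwa [if_pos h]
      · refine ⟨x, fun i hi => ?_, ?_⟩ <;> dsimp only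
        · rw [if_pos hi]
          exact hx i hi
        · rwa [if_neg (lt_irrefl _)]
  have hex : ∃ n, ∃ C₀ ⊆ C, C₀.Finite ∧ ¬ chain C₀ n :=
    ⟨N, ∅, Set.empty_subset _, Set.finite_empty, fun ⟨b, hb, hch⟩ => hN b (fun i hi => (hb i hi).1) hch⟩
  obtain ⟨C₀, hC₀, hfin, hno⟩ := Nat.find_spec hex
  have hmin : ∀ m < Nat.find hex, ∀ C₁ ⊆ C, C₁.Finite → chain C₁ m := by
    intro m hm C₁ h1 h2
    by_contra h3
    exact Nat.find_min hex hm ⟨C₁, h1, h2, h3⟩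
  obtain ⟨r, hr⟩ : ∃ r, Nat.find hex = r + 1 := by
    refine Nat.exists_eq_succ_of_ne_zero fun h0 => ?_
    rw [h0] at hno
    exact hno ⟨fun _ => Classical.arbitrary Y, by simp, fun j hj => by omega⟩
  rw [hr] at hno hmin
  obtain ⟨b, hb, hch⟩ := hmin r (by omega) C₀ hC₀ hfin
  refine ⟨C₀, hC₀, hfin, r, b, fun i hi => (hb i hi).1, fun i hi c hc => ?_,
    fun y hy hCy x hx => hext C₀ r hno b hb hch y hy hCy x hx⟩
  obtain ⟨b', hb', hch'⟩ := hmin r (by omega) (insert c C₀) (Set.insert_subset hc hC₀)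
    (hfin.insert c)
  exact hext C₀ r hno b' (fun i hi => ⟨(hb' i hi).1, (Set.subset_insert _ _).trans (hb' i hi).2⟩)
    hch' (b i) (hb i hi).1 (hb i hi).2 c fun k hk => (hb' k hk).2 (Set.mem_insert _ _)

open FirstOrder.Language

namespace SkewBrace

theorem lang_card_le : Lang.card ≤ ℵ₀ := by
  have hf : Function.Injective (fun f : Σ n, Lang.Functions n =>
      match f with
      | ⟨_, LangFunc.zero⟩ => 0
      | ⟨_, LangFunc.neg⟩ => 1
      | ⟨_, LangFunc.inv⟩ => 2
      | ⟨_, LangFunc.add⟩ => 3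
      | ⟨_, LangFunc.mul⟩ => (4 : ℕ)) := by
    rintro ⟨_, _ | _⟩ ⟨_, _ | _⟩ h <;> simp_all
  have h1 : Countable (Σ n, Lang.Functions n) := hf.countable
  have h2 : IsEmpty (Σ n, Lang.Relations n) := ⟨fun r => nomatch r.2⟩
  have : Countable Lang.Symbols := inferInstanceAs (Countable (_ ⊕ _))
  exact Cardinal.mk_le_aleph0

section Terms

variable {γ : Type*}

/-- The term `s + t`. -/
def addTerm (s t : Lang.Term γ) : Lang.Term γ :=
  Functions.apply₂ (L := Lang) (LangFunc.add : Lang.Functions 2) s t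

/-- The term `s ∘ t`. -/
def mulTerm (s t : Lang.Term γ) : Lang.Term γ :=
  Functions.apply₂ (L := Lang) (LangFunc.mul : Lang.Functions 2) s t

/-- The term `-t`. -/
def negTerm (t : Lang.Term γ) : Lang.Term γ :=
  Functions.apply₁ (L := Lang) (LangFunc.neg : Lang.Functions 1) t

/-- The term `0`. -/
def zeroTerm : Lang.Term γ :=
  Constants.term (L := Lang) (LangFunc.zero : Lang.Functions 0)

variable {B : Type u} [SkewBrace B] (v : γ → B)

@[simp]
theorem realize_addTerm (s t : Lang.Term γ) :
    (addTerm s t).realize v = s.realize v + t.realize v :=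
  Term.realize_functions_apply₂

@[simp]
theorem realize_mulTerm (s t : Lang.Term γ) :
    (mulTerm s t).realize v = s.realize v * t.realize v :=
  Term.realize_functions_apply₂

@[simp]
theorem realize_negTerm (t : Lang.Term γ) : (negTerm t).realize v = -t.realize v :=
  Term.realize_functions_apply₁

@[simp]
theorem realize_zeroTerm : (zeroTerm : Lang.Term γ).realize v = 0 :=
  Term.realize_constants

end Terms

/-- Substitute a term for the distinguished variable of a formula. -/
def substVar {β γ : Type*} (φ : Lang.Formula (β ⊕ Unit)) (t : Lang.Term (β ⊕ γ)) :
    Lang.Formula (β ⊕ γ) :=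
  BoundedFormula.subst φ (Sum.elim (fun b => Term.var (Sum.inl b)) fun _ => t)

theorem realize_substVar {β γ : Type*} {B : Type u} [SkewBrace B] (φ : Lang.Formula (β ⊕ Unit))
    (t : Lang.Term (β ⊕ γ)) (y : β → B) (z : γ → B) :
    (substVar φ t).Realize (Sum.elim y z) ↔ t.realize (Sum.elim y z) ∈ φ.fiber y := by
  rw [Formula.mem_fiber, Formula.Realize, substVar, BoundedFormula.realize_subst]
  refine iff_of_eq (congrArg (fun f => BoundedFormula.Realize φ f default) ?_)
  ext i
  rcases i with i | i <;> rfl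

/-- Being an additive subgroup is a first-order property of the parameters of a formula. -/
theorem exists_formula_isAddSubgroup {β : Type*} (φ : Lang.Formula (β ⊕ Unit)) :
    ∃ σ : Lang.Formula β, ∀ (B : Type u) [SkewBrace B] (y : β → B),
      σ.Realize y ↔ ∃ H : AddSubgroup B, (H : Set B) = φ.fiber y := by
  let x : Fin 2 → Lang.Term (β ⊕ Fin 2) := fun i => Term.var (Sum.inr i)
  refine ⟨Formula.iAlls (Fin 2) (substVar φ zeroTerm ⊓
    ((substVar φ (x 0) ⊓ substVar φ (x 1)).imp (substVar φ (addTerm (x 0) (x 1))) ⊓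
    (substVar φ (x 0)).imp (substVar φ (negTerm (x 0))))), fun B _ y => ?_⟩
  rw [Formula.realize_iAlls]
  simp only [Formula.realize_inf, Formula.realize_imp, realize_substVar, realize_zeroTerm,
    realize_addTerm, realize_negTerm, x, Term.realize_var, Sum.elim_inr]
  constructor
  · intro h
    refine ⟨⟨⟨⟨φ.fiber y, fun {a b} ha hb => ?_⟩, (h 0).1⟩, fun {a} ha => ?_⟩, rfl⟩
    · exact (h ![a, b]).2.1 ⟨ha, hb⟩
    · exact (h ![a, a]).2.2 ha
  · rintro ⟨H, hH⟩ z
    rw [← hH]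
    exact ⟨H.zero_mem, fun h => H.add_mem h.1 h.2, fun h => H.neg_mem h⟩

section Definability

variable {B : Type u} [SkewBrace B]

/-- `t` is given by a term with parameters. -/
def IsTermFun {α : Type*} (t : (α → B) → B) : Prop :=
  ∃ τ : Lang.Term (B ⊕ α), ∀ v, τ.realize (Sum.elim id v) = t v

/-- `P` is given by a formula with parameters. -/
def IsFormulaRel {α : Type*} (P : (α → B) → Prop) : Prop :=
  ∃ φ : Lang.Formula (B ⊕ α), ∀ v, φ.Realize (Sum.elim id v) ↔ P v

variable {α : Type*}

theorem IsTermFun.var (a : α) : IsTermFun fun v : α → B => v a :=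
  ⟨Term.var (Sum.inr a), fun _ => rfl⟩

theorem IsTermFun.add {s t : (α → B) → B} : IsTermFun s → IsTermFun t →
    IsTermFun fun v => s v + t v := by
  rintro ⟨σ, hσ⟩ ⟨τ, hτ⟩
  exact ⟨addTerm σ τ, fun v => by rw [realize_addTerm, hσ, hτ]⟩

theorem IsTermFun.mul {s t : (α → B) → B} : IsTermFun s → IsTermFun t →
    IsTermFun fun v => s v * t v := by
  rintro ⟨σ, hσ⟩ ⟨τ, hτ⟩
  exact ⟨mulTerm σ τ, fun v => by rw [realize_mulTerm, hσ, hτ]⟩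

theorem IsTermFun.neg {t : (α → B) → B} : IsTermFun t → IsTermFun fun v => -t v := by
  rintro ⟨τ, hτ⟩
  exact ⟨negTerm τ, fun v => by rw [realize_negTerm, hτ]⟩

theorem IsTermFun.sub {s t : (α → B) → B} (hs : IsTermFun s) (ht : IsTermFun t) :
    IsTermFun fun v => s v - t v := by
  simpa only [sub_eq_add_neg] using hs.add ht.neg

theorem IsFormulaRel.not {P : (α → B) → Prop} : IsFormulaRel P → IsFormulaRel fun v => ¬ P v := by
  rintro ⟨φ, hφ⟩
  exact ⟨φ.not, fun v => by rw [Formula.realize_not, hφ]⟩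

theorem IsFormulaRel.and {P Q : (α → B) → Prop} : IsFormulaRel P → IsFormulaRel Q →
    IsFormulaRel fun v => P v ∧ Q v := by
  rintro ⟨φ, hφ⟩ ⟨ψ, hψ⟩
  exact ⟨φ ⊓ ψ, fun v => by rw [Formula.realize_inf, hφ, hψ]⟩

theorem IsFormulaRel.imp {P Q : (α → B) → Prop} : IsFormulaRel P → IsFormulaRel Q →
    IsFormulaRel fun v => P v → Q v := by
  rintro ⟨φ, hφ⟩ ⟨ψ, hψ⟩
  exact ⟨φ.imp ψ, fun v => by rw [Formula.realize_imp, hφ, hψ]⟩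

theorem IsFormulaRel.iff {P Q : (α → B) → Prop} (hP : IsFormulaRel P) (hQ : IsFormulaRel Q) :
    IsFormulaRel fun v => P v ↔ Q v := by
  simpa only [iff_iff_implies_and_implies] using (hP.imp hQ).and (hQ.imp hP)

theorem IsFormulaRel.forall {P : (α → B) → B → Prop}
    (h : IsFormulaRel fun w : α ⊕ Unit → B => P (w ∘ Sum.inl) (w (Sum.inr ()))) :
    IsFormulaRel fun v => ∀ x, P v x := by
  obtain ⟨φ, hφ⟩ := h
  refine ⟨Formula.iAlls Unit (φ.relabel (Equiv.sumAssoc B α Unit).symm), fun v => ?_⟩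
  rw [Formula.realize_iAlls]
  have key : ∀ z : Unit → B, Sum.elim (Sum.elim id v) z ∘ (Equiv.sumAssoc B α Unit).symm =
      Sum.elim id (Sum.elim v z) := by
    intro z
    ext i
    rcases i with i | i | i <;> rfl
  simp only [Formula.realize_relabel, key, hφ]
  exact ⟨fun h x => h fun _ => x, fun h z => h _⟩

theorem IsFormulaRel.exists {P : (α → B) → B → Prop}
    (h : IsFormulaRel fun w : α ⊕ Unit → B => P (w ∘ Sum.inl) (w (Sum.inr ()))) :
    IsFormulaRel fun v => ∃ x, P v x := by
  simpa using (IsFormulaRel.forall (P := fun v x => ¬ P v x) h.not).not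

theorem IsFormulaRel.forall_lt {P : ℕ → (α → B) → Prop} {n : ℕ}
    (h : ∀ i < n, IsFormulaRel (P i)) : IsFormulaRel fun v => ∀ i < n, P i v := by
  choose! φ hφ using h
  refine ⟨Formula.iInf fun i : Fin n => φ i, fun v => ?_⟩
  rw [Formula.realize_iInf]
  exact ⟨fun h i hi => (hφ i hi v).1 (h ⟨i, hi⟩), fun h i => (hφ i i.2 v).2 (h i i.2)⟩

theorem isFormulaRel_fiber {β : Type*} (φ : Lang.Formula (β ⊕ Unit)) (y : β → B) :
    IsFormulaRel fun v : Unit → B => v () ∈ φ.fiber y := by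
  refine ⟨φ.relabel (Sum.map y id), fun v => ?_⟩
  refine Formula.realize_relabel.trans (iff_of_eq (congrArg (Formula.Realize φ) ?_))
  ext i
  rcases i with i | i <;> rfl

theorem isDefinable_iff {X : Set B} : IsDefinable X ↔ IsFormulaRel fun v : Unit → B => v () ∈ X := by
  rw [IsDefinable, Set.Definable₁, Set.definable_iff_exists_formula_sum]
  constructor
  · rintro ⟨φ, hφ⟩
    refine ⟨φ.relabel (Sum.map (fun a => a.1) fun _ => ()), fun v => ?_⟩
    have := Set.ext_iff.1 hφ fun _ => v ()
    simp only [Set.mem_ofPred_eq] at this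
    refine (Formula.realize_relabel.trans (iff_of_eq (congrArg (Formula.Realize φ) ?_))).trans this.symm
    ext i
    rcases i with i | i <;> rfl
  · rintro ⟨φ, hφ⟩
    refine ⟨φ.relabel (Sum.map (fun b => ⟨b, Set.mem_univ b⟩) fun _ => 0), ?_⟩
    ext v
    simp only [Set.mem_ofPred_eq]
    refine (hφ fun _ => v 0).symm.trans ?_
    rw [Formula.realize_relabel]
    refine iff_of_eq (congrArg _ ?_)
    ext i
    rcases i with i | i <;> rfl

theorem isDefinable_fiber {β : Type*} (φ : Lang.Formula (β ⊕ Unit)) (y : β → B) :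
    IsDefinable (φ.fiber y) :=
  isDefinable_iff.2 (isFormulaRel_fiber φ y)

theorem IsDefinable.mem {X : Set B} (hX : IsDefinable X) {t : (α → B) → B} (ht : IsTermFun t) :
    IsFormulaRel fun v => t v ∈ X := by
  obtain ⟨φ, hφ⟩ := isDefinable_iff.1 hX
  obtain ⟨τ, hτ⟩ := ht
  refine ⟨substVar φ τ, fun v => ?_⟩
  rw [realize_substVar, hτ, Formula.mem_fiber, hφ]

/-- A relation definable with parameters is a fiber of a formula without parameters. -/
theorem IsFormulaRel.exists_fiber {β : Type*} {P : (β → B) → B → Prop}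
    (h : IsFormulaRel fun w : β ⊕ Unit → B => P (w ∘ Sum.inl) (w (Sum.inr ()))) :
    ∃ (m : ℕ) (ψ : Lang.Formula ((Fin m ⊕ β) ⊕ Unit)) (b : Fin m → B), ∀ y x,
      x ∈ ψ.fiber (Sum.elim b y) ↔ P y x := by
  classical
  obtain ⟨φ, hφ⟩ := h
  let s := BoundedFormula.freeVarFinset φ
  let b : Fin s.card → B := fun k => Sum.elim id (fun _ => 0) (s.equivFin.symm k).1
  let f : s → (Fin s.card ⊕ β) ⊕ Unit := fun i =>
    Sum.elim (fun _ => Sum.inl (Sum.inl (s.equivFin i)))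
      (Sum.elim (fun j => Sum.inl (Sum.inr j)) Sum.inr) i.1
  refine ⟨s.card, BoundedFormula.restrictFreeVar φ f, b, fun y x => ?_⟩
  have := hφ (Sum.elim y fun _ => x)
  simp only [Sum.elim_inr, Sum.elim_comp_inl] at this
  rw [← this, Formula.mem_fiber, Formula.Realize, Formula.Realize]
  refine BoundedFormula.realize_restrictFreeVar _ ?_
  rintro ⟨i | i | i, hi⟩
  · simp [f, b]
  · rfl
  · rfl

theorem IsDefinable.exists_fiber {X : Set B} (hX : IsDefinable X) :
    ∃ (m : ℕ) (ψ : Lang.Formula (Fin m ⊕ Unit)) (b : Fin m → B), ψ.fiber b = X := by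
  obtain ⟨m, ψ, b, h⟩ := IsFormulaRel.exists_fiber (β := Empty) (P := fun _ x => x ∈ X)
    (hX.mem (IsTermFun.var _))
  refine ⟨m, ψ.relabel (Sum.map (Equiv.sumEmpty _ _) id), b, ?_⟩
  ext x
  rw [← h Empty.elim x, Formula.mem_fiber, Formula.mem_fiber, Formula.realize_relabel]
  refine iff_of_eq (congrArg _ ?_)
  ext i
  rcases i with (i | i) | i
  · rfl
  · exact i.elim
  · rfl

end Definability

section ChainConditions

variable {B : Type u} [SkewBrace B]

theorem IsStable.exists_forall_not_ordered (hB : IsStable B) {β : Type*} [Finite β]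
    (φ : Lang.Formula (β ⊕ Unit)) :
    ∃ N, ∀ (x : ℕ → B) (y : ℕ → β → B),
      ¬ ∀ i < N, ∀ j < N, (x i ∈ φ.fiber (y j) ↔ j ≤ i) := by
  obtain ⟨κ, hκ, hst⟩ := hB
  obtain ⟨m, ⟨e⟩⟩ := Finite.exists_equiv_fin β
  obtain ⟨N, hN⟩ := FirstOrder.Language.exists_forall_not_ordered lang_card_le (B := B) hκ
    (fun A _ h1 h2 => (hst A h1 h2).le) (φ.relabel (Sum.map e id))
  refine ⟨N, fun x y h => hN x (fun j => y j ∘ e.symm) fun i hi j hj => ?_⟩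
  rw [← h i hi j hj, Formula.mem_fiber, Formula.mem_fiber, Formula.realize_relabel]
  refine iff_of_eq (congrArg _ ?_)
  ext k
  rcases k with k | k <;> simp

theorem IsStable.exists_forall_not_isIntersectionChain (hB : IsStable B) {β : Type*} [Finite β]
    (φ : Lang.Formula (β ⊕ Unit)) :
    ∃ N, ∀ b : ℕ → β → B,
      (∀ i < N, b i ∈ {y | ∃ H : AddSubgroup B, (H : Set B) = φ.fiber y}) →
        ¬ IsIntersectionChain φ.fiber b N := by
  obtain ⟨n, hn⟩ := hB.exists_forall_not_ordered φ
  let θ : Lang.Formula ((Fin n × β) ⊕ Unit) :=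
    Formula.iInf fun k : Fin n => φ.relabel (Sum.map (fun b => (k, b)) id)
  have hθ : ∀ (y : Fin n → β → B) x, x ∈ θ.fiber (fun p => y p.1 p.2) ↔ ∀ k, x ∈ φ.fiber (y k) := by
    intro y x
    rw [Formula.mem_fiber, Formula.realize_iInf]
    refine forall_congr' fun k => ?_
    rw [Formula.mem_fiber, Formula.realize_relabel]
    refine iff_of_eq (congrArg _ ?_)
    ext i
    rcases i with i | i <;> rfl
  obtain ⟨N, hN⟩ := hB.exists_forall_not_ordered θ
  refine ⟨N + 1, not_isIntersectionChain_of_not_ordered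
    (fun b hb x => not_independent_of_not_ordered hn b hb x) fun x y h => ?_⟩
  refine hN x (fun j p => y j p.1 p.2) fun i hi j hj => ?_
  rw [hθ]
  exact h i hi j hj

/-- In a stable skew brace, the intersection of a uniformly definable family of additive subgroups
is definable. -/
theorem IsStable.isDefinable_forall_mem (hB : IsStable B) {X : B → Set B}
    (hX : IsFormulaRel fun w : Unit ⊕ Unit → B => w (Sum.inr ()) ∈ X (w (Sum.inl ()))) {T : Set B}
    (hT : ∀ t ∈ T, ∃ H : AddSubgroup B, (H : Set B) = X t) :
    IsDefinable {x | ∀ t ∈ T, x ∈ X t} := by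
  obtain ⟨m, ψ, p, hψ⟩ := IsFormulaRel.exists_fiber (P := fun y x => x ∈ X (y ())) hX
  obtain ⟨N, hN⟩ := hB.exists_forall_not_isIntersectionChain ψ
  have hψ' : ∀ t, ψ.fiber (Sum.elim p fun _ => t) = X t := fun t => Set.ext fun x => hψ _ x
  obtain ⟨C₀, hC₀, -, n, b, hbT, -, hb⟩ := exists_finite_intersection_le (S := ψ.fiber)
    (T := {y | ∃ t ∈ T, y = Sum.elim p fun _ => t}) (N := N) (fun b hb => hN b fun i hi => by
      obtain ⟨t, ht, h⟩ := hb i hi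
      rw [h, Set.mem_ofPred_eq, hψ']
      exact hT t ht) ∅
  rw [isDefinable_iff]
  have key : ∀ x, x ∈ {x | ∀ t ∈ T, x ∈ X t} ↔ ∀ i < n, x ∈ ψ.fiber (b i) := by
    intro x
    constructor
    · intro hx i hi
      obtain ⟨t, ht, h⟩ := hbT i hi
      rw [h, hψ']
      exact hx t ht
    · intro hx t ht
      rw [← hψ']
      exact hb _ ⟨t, ht, rfl⟩ (hC₀.trans (Set.empty_subset _)) x hx
  simp only [key]
  exact IsFormulaRel.forall_lt fun i _ => isFormulaRel_fiber ψ (b i)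

end ChainConditions

end SkewBrace

namespace SkewBrace

variable {B : Type u} [SkewBrace B]

/-- The map `b ↦ -a + a ∘ b`. -/
def lam (a b : B) : B := -a + a * b

theorem one_eq_zero : (1 : B) = 0 := by
  have h := skew_left_distrib (1 : B) 0 0
  simpa using h

theorem mul_eq_add_lam (a b : B) : a * b = a + lam a b := by simp [lam]

theorem lam_add (a b c : B) : lam a (b + c) = lam a b + lam a c := by
  simp [lam, skew_left_distrib, sub_eq_add_neg, add_assoc]

theorem lam_zero (a : B) : lam a 0 = 0 := by
  simp [lam, ← one_eq_zero (B := B)]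

theorem lam_neg (a b : B) : lam a (-b) = -lam a b := by
  rw [eq_neg_iff_add_eq_zero, ← lam_add, neg_add_cancel, lam_zero]

theorem lam_one (b : B) : lam 1 b = b := by
  rw [lam, one_mul, one_eq_zero, neg_zero, zero_add]

theorem lam_mul (a b c : B) : lam (a * b) c = lam a (lam b c) := by
  have h : lam b c = -b + b * c := rfl
  rw [h, lam_add, lam_neg]
  simp [lam, mul_assoc, add_assoc]

theorem lam_inv_lam (a b : B) : lam a⁻¹ (lam a b) = b := by
  rw [← lam_mul, inv_mul_cancel, lam_one]

theorem lam_lam_inv (a b : B) : lam a (lam a⁻¹ b) = b := by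
  rw [← lam_mul, mul_inv_cancel, lam_one]

theorem add_eq_mul_lam (a b : B) : a + b = a * lam a⁻¹ b := by
  rw [mul_eq_add_lam, lam_lam_inv]

theorem inv_eq_lam (a : B) : a⁻¹ = lam a⁻¹ (-a) := by
  rw [lam_neg, eq_neg_iff_add_eq_zero, ← mul_eq_add_lam, inv_mul_cancel, one_eq_zero]

theorem star_eq (a b : B) : star a b = lam a b - b := rfl

theorem lam_eq_star_add (a b : B) : lam a b = star a b + b := by simp [star_eq]

theorem IsTermFun.lam {α : Type*} {s t : (α → B) → B} (hs : IsTermFun s) (ht : IsTermFun t) :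
    IsTermFun fun v => SkewBrace.lam (s v) (t v) :=
  hs.neg.add (hs.mul ht)

end SkewBrace

open SkewBrace

namespace SkewSubbrace

variable {B : Type u} [SkewBrace B] (C : SkewSubbrace B)

theorem lam_mem {a b : B} (ha : a ∈ C.toAddSubgroup) (hb : b ∈ C.toAddSubgroup) :
    lam a b ∈ C.toAddSubgroup :=
  C.toAddSubgroup.add_mem (C.toAddSubgroup.neg_mem ha) (C.toSubgroup.mul_mem ha hb)

theorem inv_mem {a : B} (ha : a ∈ C.toAddSubgroup) : a⁻¹ ∈ C.toAddSubgroup :=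
  C.toSubgroup.inv_mem ha

theorem star_mem_derived {n : ℕ} {a b : B} (ha : a ∈ C.derived n) (hb : b ∈ C.derived n) :
    star a b ∈ C.derived (n + 1) :=
  AddSubgroup.subset_closure ⟨a, ha, b, hb, rfl⟩

theorem derived_one_le : C.derived 1 ≤ C.toAddSubgroup := by
  refine (AddSubgroup.closure_le _).2 ?_
  rintro _ ⟨a, ha, b, hb, rfl⟩
  exact C.toAddSubgroup.sub_mem (C.lam_mem ha hb) hb

theorem conj_mem_derived_one {c d : B} (hc : c ∈ C.toAddSubgroup) (hd : d ∈ C.derived 1) :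
    c + d - c ∈ C.derived 1 := by
  refine AddSubgroup.closure_induction (p := fun d _ => c + d - c ∈ C.derived 1) ?_ ?_ ?_ ?_ hd
  · rintro _ ⟨a, ha, b, hb, rfl⟩
    have h : c + star a b - c = -star a c + star a (c + b) := by
      simp [star_eq, lam_add, sub_eq_add_neg, add_assoc]
    rw [h]
    exact (C.derived 1).add_mem ((C.derived 1).neg_mem (C.star_mem_derived (n := 0) ha hc))
      (C.star_mem_derived (n := 0) ha (C.toAddSubgroup.add_mem hc hb))
  · simp [(C.derived 1).zero_mem]
  · intro x y _ _ hx hy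
    simpa [sub_eq_add_neg, add_assoc] using (C.derived 1).add_mem hx hy
  · intro x _ hx
    simpa [sub_eq_add_neg, add_assoc] using (C.derived 1).neg_mem hx

theorem lam_mem_derived_one {c d : B} (hc : c ∈ C.toAddSubgroup) (hd : d ∈ C.derived 1) :
    lam c d ∈ C.derived 1 := by
  rw [lam_eq_star_add]
  exact (C.derived 1).add_mem (C.star_mem_derived (n := 0) hc (C.derived_one_le hd)) hd

/-- The first proper term of the derived series, as a skew sub-brace. -/
def next : SkewSubbrace B where
  toAddSubgroup := C.derived 1
  mul_mem' {a b} ha hb := by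
    change a * b ∈ C.derived 1
    rw [mul_eq_add_lam]
    exact (C.derived 1).add_mem ha (C.lam_mem_derived_one (C.derived_one_le ha) hb)
  one_mem' := by
    change (1 : B) ∈ C.derived 1
    rw [one_eq_zero]
    exact (C.derived 1).zero_mem
  inv_mem' {a} ha := by
    change a⁻¹ ∈ C.derived 1
    rw [inv_eq_lam]
    exact C.lam_mem_derived_one (C.inv_mem (C.derived_one_le ha)) ((C.derived 1).neg_mem ha)

theorem derived_next (n : ℕ) : C.next.derived n = C.derived (n + 1) := by
  induction n with
  | zero => rfl
  | succ n ih =>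
    change AddSubgroup.closure _ = AddSubgroup.closure _
    rw [ih]

/-- The terms of the derived series, as skew sub-braces. -/
def derivedSubbrace (C : SkewSubbrace B) : ℕ → SkewSubbrace B
  | 0 => C
  | n + 1 => (C.derivedSubbrace n).next

theorem derived_derivedSubbrace (n m : ℕ) : (C.derivedSubbrace n).derived m = C.derived (m + n) := by
  induction n generalizing m with
  | zero => rfl
  | succ n ih =>
    rw [derivedSubbrace, derived_next, ih]
    congr 1
    omega

theorem derivedSubbrace_toAddSubgroup (n : ℕ) :
    (C.derivedSubbrace n).toAddSubgroup = C.derived n := by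
  have h := C.derived_derivedSubbrace n 0
  rwa [Nat.zero_add] at h

end SkewSubbrace

namespace SkewBrace

variable {B : Type u} [SkewBrace B]

/-- Every definable additive subgroup containing `C` contains a definable multiplicative subgroup
containing `C`. -/
theorem IsStable.exists_subgroup_le (hB : IsStable B) (C : SkewSubbrace B) {H : AddSubgroup B}
    (hH : IsDefinable (H : Set B)) (hCH : C.toAddSubgroup ≤ H) :
    ∃ K : Subgroup B, IsDefinable (K : Set B) ∧ (C : Set B) ⊆ K ∧ (K : Set B) ⊆ H := by
  let H' : AddSubgroup B :=
    { carrier := {x | ∀ c ∈ C.toAddSubgroup, lam c x ∈ H}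
      add_mem' := fun hx hy c hc => by
        rw [lam_add]
        exact H.add_mem (hx c hc) (hy c hc)
      zero_mem' := fun c hc => by
        rw [lam_zero]
        exact H.zero_mem
      neg_mem' := fun hx c hc => by
        rw [lam_neg]
        exact H.neg_mem (hx c hc) }
  have hH' : IsDefinable (H' : Set B) := by
    refine hB.isDefinable_forall_mem (X := fun c => {x | lam c x ∈ H}) (T := C.toAddSubgroup)
      (hH.mem ((IsTermFun.var _).lam (IsTermFun.var _))) fun c _ => ?_
    refine ⟨⟨⟨⟨{x | lam c x ∈ H}, fun hx hy => ?_⟩, ?_⟩, fun hx => ?_⟩, rfl⟩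
    · rw [Set.mem_ofPred_eq, lam_add]
      exact H.add_mem hx hy
    · change lam c 0 ∈ H
      rw [lam_zero]
      exact H.zero_mem
    · change lam c (-_) ∈ H
      rw [lam_neg]
      exact H.neg_mem hx
  have hinv : ∀ c ∈ C.toAddSubgroup, ∀ x ∈ H', lam c x ∈ H' := by
    intro c hc x hx d hd
    rw [← lam_mul]
    exact hx _ (C.toSubgroup.mul_mem hd hc)
  have hCH' : C.toAddSubgroup ≤ H' := fun x hx c hc => hCH (C.lam_mem hc hx)
  let K : Subgroup B :=
    { carrier := {b | b ∈ H' ∧ ∀ x, x ∈ H' ↔ lam b x ∈ H'}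
      mul_mem' := fun {a b} ha hb => by
        refine ⟨?_, fun x => ?_⟩
        · rw [mul_eq_add_lam]
          exact H'.add_mem ha.1 ((ha.2 b).1 hb.1)
        · rw [lam_mul, ← ha.2, ← hb.2]
      one_mem' := by
        refine ⟨?_, fun x => ?_⟩
        · rw [one_eq_zero]
          exact H'.zero_mem
        · rw [lam_one]
      inv_mem' := fun {a} ha => by
        refine ⟨?_, fun x => ?_⟩
        · rw [inv_eq_lam, ha.2, lam_lam_inv]
          exact H'.neg_mem ha.1
        · rw [ha.2 (lam a⁻¹ x), lam_lam_inv] }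
  refine ⟨K, ?_, fun c hc => ⟨hCH' hc, fun x => ⟨hinv c hc x, fun h => ?_⟩⟩, fun b hb => ?_⟩
  · rw [isDefinable_iff]
    refine (hH'.mem (IsTermFun.var _)).and (IsFormulaRel.forall ?_)
    exact (hH'.mem (IsTermFun.var _)).iff (hH'.mem ((IsTermFun.var _).lam (IsTermFun.var _)))
  · simpa only [lam_inv_lam] using hinv c⁻¹ (C.inv_mem hc) _ h
  · have h := hb.1 1 C.toSubgroup.one_mem
    rwa [lam_one] at h

/-- A definable additive subgroup containing `C ∗ C` can be shrunk to a definable subgroup `E` such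
that definable groups around `C` act trivially modulo `E`. -/
theorem IsStable.exists_trivial_action (hB : IsStable B) (C : SkewSubbrace B) {E₀ : AddSubgroup B}
    (hE₀ : IsDefinable (E₀ : Set B)) (hD : C.derived 1 ≤ E₀) :
    ∃ (E F : AddSubgroup B) (P : Subgroup B), IsDefinable (E : Set B) ∧ IsDefinable (F : Set B) ∧
      IsDefinable (P : Set B) ∧ E ≤ E₀ ∧ E ≤ F ∧ C.toAddSubgroup ≤ F ∧ C.toSubgroup ≤ P ∧
      (∀ b ∈ F, ∀ e ∈ E, b + e - b ∈ E) ∧ (∀ p ∈ P, ∀ e ∈ E, lam p e ∈ E) ∧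
      ∀ p ∈ P, ∀ b ∈ F, -b + lam p b ∈ E := by
  let E₁ : AddSubgroup B :=
    { carrier := {x | ∀ c ∈ C.toAddSubgroup, c + x - c ∈ E₀}
      add_mem' := fun {x y} hx hy c hc => by
        simpa [sub_eq_add_neg, add_assoc] using E₀.add_mem (hx c hc) (hy c hc)
      zero_mem' := fun c hc => by simp [E₀.zero_mem]
      neg_mem' := fun {x} hx c hc => by
        simpa [sub_eq_add_neg, add_assoc] using E₀.neg_mem (hx c hc) }
  have hE₁ : IsDefinable (E₁ : Set B) := by
    refine hB.isDefinable_forall_mem (X := fun c => {x | c + x - c ∈ E₀}) (T := C.toAddSubgroup)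
      (hE₀.mem (((IsTermFun.var _).add (IsTermFun.var _)).sub (IsTermFun.var _))) fun c _ => ?_
    refine ⟨⟨⟨⟨{x | c + x - c ∈ E₀}, fun {x y} hx hy => ?_⟩, ?_⟩, fun {x} hx => ?_⟩, rfl⟩
    · simpa [sub_eq_add_neg, add_assoc] using E₀.add_mem hx hy
    · simp [E₀.zero_mem]
    · simpa [sub_eq_add_neg, add_assoc] using E₀.neg_mem hx
  have hconj₁ : ∀ c ∈ C.toAddSubgroup, ∀ x ∈ E₁, c + x - c ∈ E₁ := by
    intro c hc x hx d hd
    simpa [sub_eq_add_neg, add_assoc] using hx _ (C.toAddSubgroup.add_mem hd hc)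
  let E : AddSubgroup B :=
    { carrier := {x | ∀ c ∈ C.toAddSubgroup, lam c x ∈ E₁}
      add_mem' := fun hx hy c hc => by
        rw [lam_add]
        exact E₁.add_mem (hx c hc) (hy c hc)
      zero_mem' := fun c hc => by
        rw [lam_zero]
        exact E₁.zero_mem
      neg_mem' := fun hx c hc => by
        rw [lam_neg]
        exact E₁.neg_mem (hx c hc) }
  have hE : IsDefinable (E : Set B) := by
    refine hB.isDefinable_forall_mem (X := fun c => {x | lam c x ∈ E₁}) (T := C.toAddSubgroup)
      (hE₁.mem ((IsTermFun.var _).lam (IsTermFun.var _))) fun c _ => ?_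
    refine ⟨⟨⟨⟨{x | lam c x ∈ E₁}, fun hx hy => ?_⟩, ?_⟩, fun hx => ?_⟩, rfl⟩
    · rw [Set.mem_ofPred_eq, lam_add]
      exact E₁.add_mem hx hy
    · change lam c 0 ∈ E₁
      rw [lam_zero]
      exact E₁.zero_mem
    · change lam c (-_) ∈ E₁
      rw [lam_neg]
      exact E₁.neg_mem hx
  have hlam : ∀ c ∈ C.toAddSubgroup, ∀ x ∈ E, lam c x ∈ E := by
    intro c hc x hx d hd
    rw [← lam_mul]
    exact hx _ (C.toSubgroup.mul_mem hd hc)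
  have hlam' : ∀ c ∈ C.toAddSubgroup, ∀ x, x ∈ E ↔ lam c x ∈ E := fun c hc x =>
    ⟨hlam c hc x, fun h => by simpa only [lam_inv_lam] using hlam c⁻¹ (C.inv_mem hc) _ h⟩
  have hconj : ∀ c ∈ C.toAddSubgroup, ∀ x ∈ E, c + x - c ∈ E := by
    intro c hc x hx d hd
    rw [sub_eq_add_neg, lam_add, lam_add, lam_neg, ← sub_eq_add_neg]
    exact hconj₁ _ (C.lam_mem hd hc) _ (hx d hd)
  have hDE : C.derived 1 ≤ E := fun x hx c hc d hd =>
    hD (C.conj_mem_derived_one hd (C.lam_mem_derived_one hc hx))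
  have hEE₀ : E ≤ E₀ := by
    intro x hx
    simpa [lam_one] using hx 1 C.toSubgroup.one_mem 0 C.toAddSubgroup.zero_mem
  let N : AddSubgroup B :=
    { carrier := {b | ∀ x, x ∈ E ↔ b + x - b ∈ E}
      add_mem' := fun {a b} ha hb x => by
        rw [hb x, ha]
        simp [sub_eq_add_neg, add_assoc]
      zero_mem' := fun x => by simp
      neg_mem' := fun {a} ha x => by
        rw [ha (-a + x - -a)]
        simp [sub_eq_add_neg, add_assoc] }
  have hN : IsDefinable (N : Set B) := by
    rw [isDefinable_iff]
    refine IsFormulaRel.forall ((hE.mem (IsTermFun.var _)).iff (hE.mem ?_))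
    exact ((IsTermFun.var _).add (IsTermFun.var _)).sub (IsTermFun.var _)
  have hCN : C.toAddSubgroup ≤ N := fun c hc x => ⟨hconj c hc x, fun h => by
    simpa [sub_eq_add_neg, add_assoc] using hconj (-c) (C.toAddSubgroup.neg_mem hc) _ h⟩
  have hEN : E ≤ N := fun e he x => by
    rw [sub_eq_add_neg, E.add_mem_cancel_right (E.neg_mem he), E.add_mem_cancel_left he]
  have hNconj : ∀ b ∈ N, ∀ e ∈ E, -b + e + b ∈ E := by
    intro b hb e he
    simpa using ((N.neg_mem hb) e).1 he
  let X : B → Set B := fun c => {b | b ∈ N ∧ -b + lam c b ∈ E}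
  have hX : ∀ c ∈ C.toAddSubgroup, ∃ H : AddSubgroup B, (H : Set B) = X c := by
    intro c hc
    refine ⟨⟨⟨⟨X c, fun {x y} hx hy => ⟨N.add_mem hx.1 hy.1, ?_⟩⟩, N.zero_mem, ?_⟩,
      fun {x} hx => ⟨N.neg_mem hx.1, ?_⟩⟩, rfl⟩
    · have h := E.add_mem (hNconj y hy.1 _ hx.2) hy.2
      simpa [lam_add, add_assoc] using h
    · simp [lam_zero, E.zero_mem]
    · have h := (hx.1 _).1 (E.neg_mem hx.2)
      simpa [lam_neg, sub_eq_add_neg, add_assoc] using h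
  let F : AddSubgroup B :=
    { carrier := {b | b ∈ N ∧ ∀ c ∈ C.toAddSubgroup, b ∈ X c}
      add_mem' := fun hx hy => ⟨N.add_mem hx.1 hy.1, fun c hc => by
        obtain ⟨H, hH⟩ := hX c hc
        have h1 := hx.2 c hc
        have h2 := hy.2 c hc
        rw [← hH] at h1 h2 ⊢
        exact H.add_mem h1 h2⟩
      zero_mem' := ⟨N.zero_mem, fun c hc => by
        obtain ⟨H, hH⟩ := hX c hc
        rw [← hH]
        exact H.zero_mem⟩
      neg_mem' := fun hx => ⟨N.neg_mem hx.1, fun c hc => by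
        obtain ⟨H, hH⟩ := hX c hc
        have h1 := hx.2 c hc
        rw [← hH] at h1 ⊢
        exact H.neg_mem h1⟩ }
  have hF : IsDefinable (F : Set B) := by
    have h : IsDefinable {b | ∀ c ∈ C.toAddSubgroup, b ∈ X c} := by
      refine hB.isDefinable_forall_mem (X := X) (T := C.toAddSubgroup) ?_ hX
      exact (hN.mem (IsTermFun.var _)).and (hE.mem ((IsTermFun.var _).neg.add
        ((IsTermFun.var _).lam (IsTermFun.var _))))
    rw [isDefinable_iff]
    exact (hN.mem (IsTermFun.var _)).and (h.mem (IsTermFun.var _))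
  have hEF : E ≤ F := fun e he => ⟨hEN he, fun c hc =>
    ⟨hEN he, E.add_mem (E.neg_mem he) (hlam c hc e he)⟩⟩
  have hCF : C.toAddSubgroup ≤ F := fun b hb => ⟨hCN hb, fun c hc => ⟨hCN hb, by
    rw [lam_eq_star_add, ← add_assoc]
    exact hNconj b (hCN hb) _ (hDE (C.star_mem_derived (n := 0) hc hb))⟩⟩
  let P : Subgroup B :=
    { carrier := {p | (∀ x, x ∈ E ↔ lam p x ∈ E) ∧ ∀ b, b ∈ F → -b + lam p b ∈ E}
      mul_mem' := fun {p q} hp hq => by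
        refine ⟨fun x => ?_, fun b hb => ?_⟩
        · rw [lam_mul, ← hp.1, ← hq.1]
        · have h := E.add_mem (hp.2 b hb) ((hp.1 _).1 (hq.2 b hb))
          simpa [lam_mul, lam_add, lam_neg, add_assoc] using h
      one_mem' := ⟨fun x => by rw [lam_one], fun b _ => by simp [lam_one, E.zero_mem]⟩
      inv_mem' := fun {p} hp => by
        refine ⟨fun x => ?_, fun b hb => ?_⟩
        · rw [hp.1 (lam p⁻¹ x), lam_lam_inv]
        · rw [hp.1, lam_add, lam_neg, lam_lam_inv]
          simpa using E.neg_mem (hp.2 b hb) }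
  have hP : IsDefinable (P : Set B) := by
    rw [isDefinable_iff]
    refine (IsFormulaRel.forall ?_).and (IsFormulaRel.forall ?_)
    · exact (hE.mem (IsTermFun.var _)).iff (hE.mem ((IsTermFun.var _).lam (IsTermFun.var _)))
    · exact (hF.mem (IsTermFun.var _)).imp (hE.mem ((IsTermFun.var _).neg.add
        ((IsTermFun.var _).lam (IsTermFun.var _))))
  exact ⟨E, F, P, hE, hF, hP, hEE₀, hEF, hCF, fun c hc => ⟨hlam' c hc, fun b hb => (hb.2 c hc).2⟩,
    fun b hb e he => (hb.1 e).1 he, fun p hp e he => (hp.1 e).1 he, fun p hp b hb => hp.2 b hb⟩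

/-- The trivial subgroup is definable. -/
theorem isDefinable_bot : IsDefinable ((⊥ : AddSubgroup B) : Set B) := by
  refine isDefinable_iff.2 ⟨Term.equal (Term.var (Sum.inr ())) zeroTerm, fun v => ?_⟩
  rw [Formula.realize_equal, realize_zeroTerm]
  rfl

/-- Every definable multiplicative subgroup containing the weakly soluble skew sub-brace `C`
contains a definable additive subgroup containing `C`. -/
theorem IsStable.exists_addSubgroup_le (hB : IsStable B) {k : ℕ} (C : SkewSubbrace B)
    (hC : C.derived k = ⊥) {G : Subgroup B} (hG : IsDefinable (G : Set B))
    (hCG : C.toSubgroup ≤ G) :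
    ∃ A : AddSubgroup B, IsDefinable (A : Set B) ∧ (C : Set B) ⊆ A ∧ (A : Set B) ⊆ G := by
  induction k generalizing C with
  | zero =>
    refine ⟨⊥, isDefinable_bot, ?_, ?_⟩
    · rw [← hC]
      exact subset_rfl
    · simp only [AddSubgroup.coe_bot, Set.singleton_subset_iff, SetLike.mem_coe]
      rw [← one_eq_zero]
      exact G.one_mem
  | succ k ih =>
    obtain ⟨E₀, hE₀, hD, hE₀G⟩ := ih C.next (by rw [SkewSubbrace.derived_next, hC])
      fun x hx => hCG (C.derived_one_le hx)
    obtain ⟨E, F, P, hE, hF, hP, hEE₀, hEF, hCF, hCP, hconj, hlam, hact⟩ :=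
      hB.exists_trivial_action C hE₀ hD
    have hEG : ∀ e ∈ E, e ∈ G := fun e he => hE₀G (hEE₀ he)
    have hact' : ∀ p ∈ P, ∀ b ∈ F, lam p b ∈ F := fun p hp b hb => by
      simpa using F.add_mem hb (hEF (hact p hp b hb))
    have hconj' : ∀ b ∈ F, ∀ e ∈ E, -b + e + b ∈ E := fun b hb e he => by
      simpa using hconj (-b) (F.neg_mem hb) e he
    let A : AddSubgroup B :=
      { carrier := {x | ∃ q, (q ∈ G ∧ q ∈ P ∧ q ∈ F) ∧ -q + x ∈ E}
        add_mem' := fun {x y} => by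
          rintro ⟨q, ⟨hqG, hqP, hqF⟩, hx⟩ ⟨r, ⟨hrG, hrP, hrF⟩, hy⟩
          refine ⟨q * r, ⟨G.mul_mem hqG hrG, P.mul_mem hqP hrP, ?_⟩, ?_⟩
          · rw [mul_eq_add_lam]
            exact F.add_mem hqF (hact' q hqP r hrF)
          · have h := E.add_mem (E.neg_mem (hact q hqP r hrF))
              (E.add_mem (hconj' r hrF _ hx) hy)
            simpa [mul_eq_add_lam, add_assoc] using h
        zero_mem' := ⟨1, ⟨G.one_mem, P.one_mem, by rw [one_eq_zero]; exact F.zero_mem⟩, by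
          rw [one_eq_zero]
          simp [E.zero_mem]⟩
        neg_mem' := fun {x} => by
          rintro ⟨q, ⟨hqG, hqP, hqF⟩, hx⟩
          have hqF' := hact' _ (P.inv_mem hqP) _ (F.neg_mem hqF)
          rw [← inv_eq_lam] at hqF'
          refine ⟨q⁻¹, ⟨G.inv_mem hqG, P.inv_mem hqP, hqF'⟩, ?_⟩
          have h1 := hact _ (P.inv_mem hqP) _ (F.neg_mem hqF)
          rw [← inv_eq_lam] at h1
          have h2 := hconj q hqF _ (E.neg_mem hx)
          have h := E.add_mem (E.neg_mem h1) h2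
          simpa [sub_eq_add_neg, add_assoc] using h }
    refine ⟨A, ?_, fun c hc => ⟨c, ⟨hCG hc, hCP hc, hCF hc⟩, by simp [E.zero_mem]⟩, ?_⟩
    · rw [isDefinable_iff]
      refine IsFormulaRel.exists (((hG.mem (IsTermFun.var _)).and ((hP.mem (IsTermFun.var _)).and
        (hF.mem (IsTermFun.var _)))).and (hE.mem ((IsTermFun.var _).neg.add (IsTermFun.var _))))
    · rintro x ⟨q, ⟨hqG, hqP, hqF⟩, hx⟩
      have h : x = q * lam q⁻¹ (-q + x) := by
        rw [← add_eq_mul_lam]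
        simp
      rw [h]
      exact G.mul_mem hqG (hEG _ (hlam _ (P.inv_mem hqP) _ hx))

end SkewBrace

namespace SkewSubbrace

variable {B : Type u} [SkewBrace B]

theorem derived_succ_le (C : SkewSubbrace B) (n : ℕ) : C.derived (n + 1) ≤ C.derived n := by
  have h := (C.derivedSubbrace n).derived_one_le
  rwa [derived_derivedSubbrace, derivedSubbrace_toAddSubgroup, Nat.add_comm] at h

theorem derived_antitone (C : SkewSubbrace B) : Antitone C.derived :=
  antitone_nat_of_succ_le C.derived_succ_le

theorem derived_mono {C C' : SkewSubbrace B} (h : C.toAddSubgroup ≤ C'.toAddSubgroup) (n : ℕ) :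
    C.derived n ≤ C'.derived n := by
  induction n with
  | zero => exact h
  | succ n ih =>
    refine AddSubgroup.closure_mono ?_
    rintro _ ⟨a, ha, b, hb, rfl⟩
    exact ⟨a, ih ha, b, ih hb, rfl⟩

theorem derivedSubbrace_coe (C : SkewSubbrace B) (n : ℕ) :
    (C.derivedSubbrace n : Set B) = (C.derived n : Set B) := by
  rw [← derivedSubbrace_toAddSubgroup]
  rfl

end SkewSubbrace

namespace SkewBrace

section Hulls

variable {B : Type u} [SkewBrace B]

theorem mem_addHull {X : Set B} {x : B} :
    x ∈ addHull X ↔ ∀ H : AddSubgroup B, IsDefinable (H : Set B) → X ⊆ H → x ∈ H := by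
  rw [addHull, AddSubgroup.mem_sInf]
  exact ⟨fun h H h1 h2 => h H ⟨h1, h2⟩, fun h H hH => h H hH.1 hH.2⟩

theorem mem_mulHull {X : Set B} {x : B} :
    x ∈ mulHull X ↔ ∀ H : Subgroup B, IsDefinable (H : Set B) → X ⊆ H → x ∈ H := by
  rw [mulHull, Subgroup.mem_sInf]
  exact ⟨fun h H h1 h2 => h H ⟨h1, h2⟩, fun h H hH => h H hH.1 hH.2⟩

theorem subset_addHull (X : Set B) : X ⊆ addHull X := fun _ hx =>
  mem_addHull.2 fun _ _ h => h hx

theorem IsStable.mulHull_subset_addHull (hB : IsStable B) (C : SkewSubbrace B) :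
    (mulHull (C : Set B) : Set B) ⊆ addHull (C : Set B) := by
  intro x hx
  refine mem_addHull.2 fun H hH hC => ?_
  obtain ⟨K, hK, hCK, hKH⟩ := hB.exists_subgroup_le C hH hC
  exact hKH (mem_mulHull.1 hx K hK hCK)

theorem IsStable.addHull_eq_mulHull (hB : IsStable B) (C : SkewSubbrace B) {k : ℕ}
    (hC : C.derived k = ⊥) : (addHull (C : Set B) : Set B) = mulHull (C : Set B) := by
  refine subset_antisymm (fun x hx => mem_mulHull.2 fun G hG hCG => ?_)
    (hB.mulHull_subset_addHull C)
  obtain ⟨A, hA, hCA, hAG⟩ := hB.exists_addSubgroup_le C hC hG hCG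
  exact hAG (mem_addHull.1 hx A hA hCA)

theorem IsStable.star_mem_addHull (hB : IsStable B) (C : SkewSubbrace B) {a b : B}
    (ha : a ∈ mulHull (C : Set B)) (hb : b ∈ addHull (C : Set B)) :
    star a b ∈ addHull (C.derived 1 : Set B) := by
  refine mem_addHull.2 fun E₀ hE₀ hD => ?_
  obtain ⟨E, F, P, -, hF, hP, hEE₀, -, hCF, hCP, hconj, -, hact⟩ :=
    hB.exists_trivial_action C hE₀ hD
  have hbF := mem_addHull.1 hb F hF hCF
  have h := hconj b hbF _ (hact a (mem_mulHull.1 ha P hP hCP) b hbF)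
  refine hEE₀ ?_
  simpa [star_eq] using h

/-- The hulls of the terms of the derived series of a weakly soluble skew sub-brace. -/
theorem IsStable.exists_hulls (hB : IsStable B) (C : SkewSubbrace B) {k : ℕ}
    (hC : C.IsWeaklySolubleOfLength k) :
    ∃ S : ℕ → SkewSubbrace B,
      (∀ n, (addHull (C.derived n : Set B) : Set B) = S n ∧
        (mulHull (C.derived n : Set B) : Set B) = S n) ∧
      (S 0).IsWeaklySolubleOfLength k ∧
      ∀ n, ∀ a ∈ (S n : Set B), ∀ b ∈ (S n : Set B), star a b ∈ (S (n + 1) : Set B) := by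
  have hS : ∀ n, ∃ S : SkewSubbrace B, (addHull (C.derived n : Set B) : Set B) = S ∧
      (mulHull (C.derived n : Set B) : Set B) = S := by
    intro n
    have h0 : (C.derivedSubbrace n).derived k = ⊥ := by
      rw [SkewSubbrace.derived_derivedSubbrace, eq_bot_iff, ← hC.1]
      exact C.derived_antitone (Nat.le_add_right _ _)
    have h := hB.addHull_eq_mulHull _ h0
    rw [SkewSubbrace.derivedSubbrace_coe] at h
    have hmem : ∀ x, x ∈ addHull (C.derived n : Set B) ↔ x ∈ mulHull (C.derived n : Set B) :=
      Set.ext_iff.1 h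
    refine ⟨⟨addHull (C.derived n : Set B), fun {a b} ha hb => ?_, ?_, fun {a} ha => ?_⟩, rfl,
      h.symm⟩
    · exact (hmem _).2 (mul_mem ((hmem _).1 ha) ((hmem _).1 hb))
    · exact (hmem _).2 (one_mem _)
    · exact (hmem _).2 (inv_mem ((hmem _).1 ha))
  choose S hS using hS
  have hSadd : ∀ n x, x ∈ (S n).toAddSubgroup ↔ x ∈ addHull (C.derived n : Set B) := fun n x =>
    (Set.ext_iff.1 (hS n).1 x).symm
  have hSmul : ∀ n x, x ∈ (S n).toAddSubgroup ↔ x ∈ mulHull (C.derived n : Set B) := fun n x =>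
    (Set.ext_iff.1 (hS n).2 x).symm
  have hstar : ∀ n, ∀ a ∈ (S n).toAddSubgroup, ∀ b ∈ (S n).toAddSubgroup,
      star a b ∈ (S (n + 1)).toAddSubgroup := by
    intro n a ha b hb
    have h := hB.star_mem_addHull (C.derivedSubbrace n) (a := a) (b := b)
    rw [SkewSubbrace.derivedSubbrace_coe, SkewSubbrace.derived_derivedSubbrace, Nat.add_comm] at h
    exact (hSadd _ _).2 (h ((hSmul n a).1 ha) ((hSadd n b).1 hb))
  refine ⟨S, hS, ⟨?_, fun m hm h => hC.2 m hm ?_⟩, hstar⟩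
  · have hle : ∀ m, (S 0).derived m ≤ (S m).toAddSubgroup := by
      intro m
      induction m with
      | zero => exact le_rfl
      | succ m ih =>
        refine (AddSubgroup.closure_le _).2 ?_
        rintro _ ⟨a, ha, b, hb, rfl⟩
        exact hstar m a (ih ha) b (ih hb)
    rw [eq_bot_iff]
    intro x hx
    refine mem_addHull.1 ((hSadd k x).1 (hle k hx)) ⊥ isDefinable_bot ?_
    rw [hC.1]
  · rw [eq_bot_iff, ← h]
    exact SkewSubbrace.derived_mono (fun x hx => (hSadd 0 x).2 (subset_addHull _ hx)) m

end Hulls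

section ElementaryExtensions

theorem IsStable.of_elementaryEmbedding {B B' : Type u} [SkewBrace B] [SkewBrace B']
    (hB : IsStable B) (f : B ↪ₑ[Lang] B') : IsStable B' := by
  obtain ⟨κ, hκ, h⟩ := hB
  refine ⟨κ, hκ, fun A _ hA => h A ?_⟩
  rwa [show Lang.completeTheory B = Lang.completeTheory B' from f.elementarilyEquivalent]

variable {B B' : Type u} [SkewBrace B] [SkewBrace B'] (f : B ↪ₑ[Lang] B')

theorem map_add' (a b : B) : f (a + b) = f a + f b := by
  have h := f.map_fun (LangFunc.add : Lang.Functions 2) ![a, b]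
  exact h

theorem map_mul' (a b : B) : f (a * b) = f a * f b := by
  have h := f.map_fun (LangFunc.mul : Lang.Functions 2) ![a, b]
  exact h

theorem map_inv' (a : B) : f a⁻¹ = (f a)⁻¹ := by
  have h := f.map_fun (LangFunc.inv : Lang.Functions 1) ![a]
  exact h

/-- An elementary embedding as a homomorphism of additive groups. -/
def addHom : B →+ B' := AddMonoidHom.mk' f (map_add' f)

theorem addHom_apply (a : B) : addHom f a = f a := rfl

theorem map_star (a b : B) : f (star a b) = star (f a) (f b) := by
  simp only [star, ← addHom_apply, map_sub, map_add, map_neg]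
  simp only [addHom_apply, map_mul']

/-- The image of a skew sub-brace under an elementary embedding. -/
def mapSubbrace (C : SkewSubbrace B) : SkewSubbrace B' where
  toAddSubgroup := C.toAddSubgroup.map (addHom f)
  mul_mem' := by
    rintro _ _ ⟨a, ha, rfl⟩ ⟨b, hb, rfl⟩
    exact ⟨a * b, C.toSubgroup.mul_mem ha hb, map_mul' f a b⟩
  one_mem' := ⟨0, C.toAddSubgroup.zero_mem, by rw [map_zero, one_eq_zero]⟩
  inv_mem' := by
    rintro _ ⟨a, ha, rfl⟩
    exact ⟨a⁻¹, C.toSubgroup.inv_mem ha, map_inv' f a⟩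

theorem mapSubbrace_derived (C : SkewSubbrace B) (n : ℕ) :
    (mapSubbrace f C).derived n = (C.derived n).map (addHom f) := by
  induction n with
  | zero => rfl
  | succ n ih =>
    rw [SkewSubbrace.derived, SkewSubbrace.derived, AddMonoidHom.map_closure, ih]
    congr 1
    ext x
    constructor
    · rintro ⟨_, ⟨a, ha, rfl⟩, _, ⟨b, hb, rfl⟩, rfl⟩
      exact ⟨star a b, ⟨a, ha, b, hb, rfl⟩, map_star f a b⟩
    · rintro ⟨_, ⟨a, ha, b, hb, rfl⟩, rfl⟩
      exact ⟨f a, ⟨a, ha, rfl⟩, f b, ⟨b, hb, rfl⟩, map_star f a b⟩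

theorem mapSubbrace_isWeaklySolubleOfLength {C : SkewSubbrace B} {k : ℕ}
    (hC : C.IsWeaklySolubleOfLength k) : (mapSubbrace f C).IsWeaklySolubleOfLength k := by
  have h : ∀ n, (mapSubbrace f C).derived n = ⊥ ↔ C.derived n = ⊥ := fun n => by
    rw [mapSubbrace_derived]
    exact AddSubgroup.map_eq_bot_iff_of_injective _ f.injective
  exact ⟨(h k).2 hC.1, fun m hm h' => hC.2 m hm ((h m).1 h')⟩

/-- The formulas over `B` defining additive subgroups of `B` that contain `X`. -/
def hullType (X : Set B) : Set (Lang.Formula (B ⊕ Unit)) :=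
  {φ | ∃ H : AddSubgroup B, (H : Set B) = φ.fiber id ∧ X ⊆ H}

/-- In every elementary extension, the definable subgroups over the base cut out the definable
hull. -/
theorem IsStable.realizations_hullType (hB : IsStable B) (X : Set B) :
    realizations (hullType X) f = (addHull (f '' X) : Set B') := by
  refine subset_antisymm (fun x hx => mem_addHull.2 fun H hH hXH => ?_) fun x hx φ hφ => ?_
  · obtain ⟨m, ψ, b', hb'⟩ := hH.exists_fiber
    obtain ⟨σ, hσ⟩ := exists_formula_isAddSubgroup.{u} ψ
    obtain ⟨N, hN⟩ := hB.exists_forall_not_isIntersectionChain ψ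
    obtain ⟨C₀, hC₀, hfin, n, b, hbT, hXb, hmin⟩ := exists_finite_intersection_le hN X
    have := hfin.to_subtype
    let χ : Lang.Formula (B ⊕ Unit) := Formula.iInf fun i : Fin n => ψ.relabel (Sum.map (b i) id)
    have hχ : ∀ (M : Type u) [SkewBrace M] (g : B → M) (z : M),
        z ∈ χ.fiber g ↔ ∀ i < n, z ∈ ψ.fiber (g ∘ b i) := by
      intro M _ g z
      have e : ∀ i : Fin n, (Sum.elim g (fun _ => z) ∘ Sum.map (b i) id : Fin m ⊕ Unit → M) =
          Sum.elim (g ∘ b i) fun _ => z := by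
        intro i
        ext j
        rcases j with j | j <;> rfl
      rw [Formula.mem_fiber, Formula.realize_iInf]
      simp only [Formula.realize_relabel, e, Formula.mem_fiber]
      exact ⟨fun h i hi => h ⟨i, hi⟩, fun h i => h i i.2⟩
    have hχπ : χ ∈ hullType X := by
      choose! K hK using hbT
      have hmem : ∀ z, z ∈ χ.fiber id ↔ ∀ i < n, z ∈ K i := by
        intro z
        rw [hχ B id z]
        refine forall₂_congr fun i hi => ?_
        rw [← SetLike.mem_coe, hK i hi]
        rfl
      refine ⟨⟨⟨⟨χ.fiber id, fun {a c} ha hc => ?_⟩, ?_⟩, fun {a} ha => ?_⟩, rfl, fun z hz => ?_⟩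
      · exact (hmem _).2 fun i hi => add_mem ((hmem a).1 ha i hi) ((hmem c).1 hc i hi)
      · exact (hmem _).2 fun i hi => zero_mem _
      · exact (hmem _).2 fun i hi => neg_mem ((hmem a).1 ha i hi)
      · exact (hχ B id z).2 fun i hi => hXb i hi hz
    have hxb := (hχ B' f x).1 (hx χ hχπ)
    let τ : Lang.Formula B := Formula.iAlls (Fin m ⊕ Unit)
      (((σ.relabel fun j => Sum.inr (Sum.inl j)) ⊓
        ((Formula.iInf fun c : C₀ => ψ.relabel
          (Sum.elim (fun j => Sum.inr (Sum.inl j)) fun _ => Sum.inl c.1)) ⊓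
        χ.relabel (Sum.map id Sum.inr))).imp (ψ.relabel Sum.inr))
    have hτ : ∀ (M : Type u) [SkewBrace M] (g : B → M), τ.Realize g ↔
        ∀ (y : Fin m → M) (z : M), ((∃ H : AddSubgroup M, (H : Set M) = ψ.fiber y) ∧
          (∀ c : C₀, g c ∈ ψ.fiber y) ∧ z ∈ χ.fiber g) → z ∈ ψ.fiber y := by
      intro M _ g
      have e0 : ∀ w : Fin m ⊕ Unit → M, w = Sum.elim (w ∘ Sum.inl) fun _ => w (Sum.inr ()) := by
        intro w
        ext j
        rcases j with j | j <;> rfl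
      have e1 : ∀ (w : Fin m ⊕ Unit → M),
          (Sum.elim g w ∘ fun j => Sum.inr (Sum.inl j)) = w ∘ Sum.inl := fun w => rfl
      have e2 : ∀ (w : Fin m ⊕ Unit → M) (c : C₀),
          (Sum.elim g w ∘ Sum.elim (fun j => Sum.inr (Sum.inl j)) fun _ : Unit => Sum.inl c.1) =
            Sum.elim (w ∘ Sum.inl) fun _ => g c := by
        intro w c
        ext j
        rcases j with j | j <;> rfl
      have e3 : ∀ (w : Fin m ⊕ Unit → M),
          (Sum.elim g w ∘ Sum.map id Sum.inr : B ⊕ Unit → M) =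
            Sum.elim g fun _ => w (Sum.inr ()) := by
        intro w
        ext j
        rcases j with j | j <;> rfl
      rw [Formula.realize_iAlls]
      simp only [Formula.realize_imp, Formula.realize_inf, Formula.realize_iInf,
        Formula.realize_relabel, e1, e2, e3, hσ, Formula.mem_fiber]
      constructor
      · intro h y z
        exact h (Sum.elim y fun _ => z)
      · intro h w
        have hw := h (w ∘ Sum.inl) (w (Sum.inr ()))
        rw [← e0] at hw
        exact hw
    have hτB : τ.Realize (id : B → B) := (hτ B id).2 fun y z ⟨h1, h2, h3⟩ =>
      hmin y h1 (fun c hc => h2 ⟨c, hc⟩) z ((hχ B id z).1 h3)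
    have hτB' : τ.Realize f := (f.map_formula τ id).2 hτB
    rw [← SetLike.mem_coe, ← hb']
    refine (hτ B' f).1 hτB' b' x ⟨⟨H, hb'.symm⟩, fun c => ?_, (hχ B' f x).2 hxb⟩
    rw [hb']
    exact hXH ⟨c, hC₀ c.2, rfl⟩
  · obtain ⟨H, hH, hXH⟩ := hφ
    obtain ⟨σ, hσ⟩ := exists_formula_isAddSubgroup.{u} φ
    obtain ⟨H', hH'⟩ := (hσ B' f).1 ((f.map_formula σ id).2 ((hσ B id).2 ⟨H, hH⟩))
    have hx' : x ∈ H' := by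
      refine mem_addHull.1 hx H' ?_ ?_
      · rw [hH']
        exact isDefinable_fiber φ f
      · rw [hH']
        rintro _ ⟨c, hc, rfl⟩
        have hc' : c ∈ φ.fiber id := hH ▸ hXH hc
        have h := (f.map_formula φ _).2 hc'
        rw [Formula.mem_fiber]
        convert h using 1
        ext j
        rcases j with j | j <;> rfl
    rw [← SetLike.mem_coe, hH'] at hx'
    exact hx'

end ElementaryExtensions

section OmegaStable

variable {B : Type u} [SkewBrace B]

/-- The partial sums of the subsequence of `x` selected by `η`. -/
def branchSum (x : ℕ → B) (η : ℕ → Bool) : ℕ → B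
  | 0 => 0
  | n + 1 => branchSum x η n + if η n then x n else 0

/-- An `ω`-stable skew brace has the descending chain condition on definable additive subgroups. -/
theorem IsOmegaStable.not_strictAnti (hB : IsOmegaStable B) (H : ℕ → AddSubgroup B)
    (hH : ∀ n, IsDefinable (H n : Set B)) : ¬ StrictAnti H := by
  intro hanti
  have hinf : Infinite B := by
    by_contra hfin
    rw [not_infinite_iff_finite] at hfin
    exact not_injective_infinite_finite H hanti.injective
  have hx : ∀ n, ∃ x, x ∈ H n ∧ x ∉ H (n + 1) := fun n =>
    SetLike.exists_of_lt (hanti n.lt_succ_self)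
  choose x hx hx' using hx
  choose m ψ b hψ using fun n => (hH n).exists_fiber
  obtain ⟨A, hA, hcard⟩ := exists_elementarySubstructure_card_eq Lang
    (Set.range x ∪ ⋃ n, Set.range (b n)) (ℵ₀ : Cardinal.{u}) le_rfl
    (by
      simp only [lift_aleph0, lift_le_aleph0, le_aleph0_iff_set_countable]
      exact (Set.countable_range x).union (Set.countable_iUnion fun n => Set.countable_range _))
    (by simpa using lang_card_le) (by simp [aleph0_le_mk])
  have hA0 : #A = ℵ₀ := by simpa using hcard
  have hAB : A ⊨ Lang.completeTheory B := A.elementarilyEquivalent.symm.theory_model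
  have htypes := hB A hAB hA0
  have hxA : ∀ n, x n ∈ A := fun n => hA (Or.inl ⟨n, rfl⟩)
  have hbA : ∀ n k, b n k ∈ A := fun n k => hA (Or.inr (Set.mem_iUnion.2 ⟨n, k, rfl⟩))
  have h0A : (0 : B) ∈ A := A.toSubstructure.fun_mem (LangFunc.zero : Lang.Functions 0) ![] (by simp)
  have haddA : ∀ a ∈ A, ∀ c ∈ A, a + c ∈ A := fun a ha c hc =>
    A.toSubstructure.fun_mem (LangFunc.add : Lang.Functions 2) ![a, c] (by
      intro i
      fin_cases i
      · exact ha
      · exact hc)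
  have hsA : ∀ η n, branchSum x η n ∈ A := by
    intro η n
    induction n with
    | zero => exact h0A
    | succ n ih =>
      refine haddA _ ih _ ?_
      split_ifs
      · exact hxA n
      · exact h0A
  have hs : ∀ η n k, -branchSum x η n + branchSum x η (n + k) ∈ H n := by
    intro η n k
    induction k with
    | zero => simp [(H n).zero_mem]
    | succ k ih =>
      rw [← add_assoc n, branchSum, ← add_assoc]
      refine (H n).add_mem ih ?_
      split_ifs
      · exact hanti.antitone (Nat.le_add_right n k) (hx _)
      · exact (H n).zero_mem
  have : Nonempty A := ⟨⟨0, h0A⟩⟩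
  let cell : (ℕ → Bool) → ℕ → Set A := fun η n => {a | -branchSum x η n + a ∈ H n}
  have key := card_le_card_completeType (L := Lang) (A := A)
    (fun η : ℕ → Bool => Set.range (cell η)) ?_ ?_ ?_
  · rw [htypes] at key
    refine absurd key ?_
    simp [Cardinal.aleph0_lt_continuum]
  · rintro η _ ⟨n, rfl⟩
    let t : Lang.Term (A ⊕ Unit) :=
      addTerm (negTerm (Term.var (Sum.inl ⟨_, hsA η n⟩))) (Term.var (Sum.inr ()))
    let φ : Lang.Formula (A ⊕ Unit) := (ψ n).relabel (Sum.map (fun k => ⟨_, hbA n k⟩) id)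
    refine ⟨substVar φ t, ?_⟩
    ext a
    have e : A.subtype ∘ Sum.elim id (fun _ : Unit => a) = Sum.elim (fun a : A => (a : B))
        fun _ => (a : B) := by
      ext j
      rcases j with j | j <;> rfl
    rw [Formula.mem_fiber, ← A.subtype.map_formula, e, realize_substVar]
    change _ ↔ _ ∈ (H n : Set B)
    rw [← hψ, Formula.mem_fiber, Formula.mem_fiber, Formula.realize_relabel]
    refine iff_of_eq (congrArg _ ?_)
    ext j
    rcases j with j | j
    · rfl
    · simp [t]
  · intro η s hs' hfin
    choose! n hn using hs'
    obtain ⟨N, hN⟩ := (hfin.image n).bddAbove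
    refine ⟨⟨_, hsA η N⟩, fun X hX => ?_⟩
    rw [← hn hX]
    obtain ⟨k, hk⟩ := Nat.exists_eq_add_of_le (hN ⟨X, hX, rfl⟩)
    change -_ + branchSum x η N ∈ H _
    rw [hk]
    exact hs _ _ _
  · intro η ζ hne
    have hex : ∃ n, η n ≠ ζ n := Function.ne_iff.1 hne
    classical
    let n := Nat.find hex
    have hn : η n ≠ ζ n := Nat.find_spec hex
    have heq : ∀ l ≤ n, branchSum x η l = branchSum x ζ l := by
      intro l
      induction l with
      | zero => intro _; rfl
      | succ l ih =>
        intro hl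
        have : η l = ζ l := not_not.1 (Nat.find_min hex hl)
        rw [branchSum, branchSum, ih (by omega), this]
    refine ⟨_, ⟨n + 1, rfl⟩, _, ⟨n + 1, rfl⟩, Set.disjoint_left.2 fun a h1 h2 => hx' n ?_⟩
    have hd := (H (n + 1)).sub_mem h1 h2
    have hd' := (H (n + 1)).sub_mem h2 h1
    simp only [branchSum, heq n le_rfl] at hd hd'
    rcases h : η n <;> rcases h' : ζ n <;> simp_all [sub_eq_add_neg, add_assoc]

theorem IsDefinable.inter {X Y : Set B} (hX : IsDefinable X) (hY : IsDefinable Y) :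
    IsDefinable (X ∩ Y) :=
  isDefinable_iff.2 ((hX.mem (IsTermFun.var _)).and (hY.mem (IsTermFun.var _)))

theorem IsOmegaStable.isDefinable_addHull (hB : IsOmegaStable B) (X : Set B) :
    IsDefinable (addHull X : Set B) := by
  by_contra hX
  have hstep : ∀ H : {H : AddSubgroup B // IsDefinable (H : Set B) ∧ X ⊆ H},
      ∃ K : {H : AddSubgroup B // IsDefinable (H : Set B) ∧ X ⊆ H}, K.1 < H.1 := by
    rintro ⟨H, hH, hXH⟩
    by_contra! hno
    refine hX ?_
    have : addHull X = H := by
      refine le_antisymm (fun x hx => mem_addHull.1 hx H hH hXH) fun x hx => ?_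
      refine mem_addHull.2 fun K hK hXK => ?_
      have h := hno ⟨H ⊓ K, hH.inter hK, fun z hz => ⟨hXH hz, hXK hz⟩⟩
      exact ((eq_of_le_of_not_lt inf_le_left h).ge hx).2
    rwa [this]
  choose K hK using hstep
  have htop : IsDefinable ((⊤ : AddSubgroup B) : Set B) :=
    isDefinable_iff.2 ⟨⊤, fun v => by simp⟩
  let H : ℕ → {H : AddSubgroup B // IsDefinable (H : Set B) ∧ X ⊆ H} := fun n =>
    Nat.rec ⟨⊤, htop, fun _ _ => AddSubgroup.mem_top _⟩ (fun _ H => K H) n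
  exact hB.not_strictAnti (fun n => (H n).1) (fun n => (H n).2.1)
    (strictAnti_nat_of_succ_lt fun n => hK (H n))

end OmegaStable

end SkewBrace

/-- `S n` is the common hull of `C_(n+1)`. Type-definability is meant in the sense that survives
elementary extensions: one set `π` of formulas over `B` defines the hull of `C`, and a weakly
soluble skew sub-brace of derived length `k`, in every elementary extension of `B`
(in particular in `B` itself, through the identity). -/
theorem mainTheorem5 {B : Type u} [SkewBrace B] (hB : SkewBrace.IsStable B)
    (C : SkewSubbrace B) (k : ℕ) (hC : C.IsWeaklySolubleOfLength k) :
    ∃ S : ℕ → SkewSubbrace B,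
      (∀ n, (SkewBrace.addHull (C.derived n : Set B) : Set B) = S n ∧
        (SkewBrace.mulHull (C.derived n : Set B) : Set B) = S n) ∧
      (S 0).IsWeaklySolubleOfLength k ∧
      (∃ π : Set (SkewBrace.Lang.Formula (B ⊕ Unit)),
        SkewBrace.realizations π (FirstOrder.Language.ElementaryEmbedding.refl SkewBrace.Lang B) =
          S 0 ∧
        ∀ (B' : Type u) [SkewBrace B'] (f : B ↪ₑ[SkewBrace.Lang] B'),
          ∃ S' : SkewSubbrace B',
            SkewBrace.realizations π f = S' ∧
            (SkewBrace.addHull (f '' (C : Set B)) : Set B') = S' ∧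
            (SkewBrace.mulHull (f '' (C : Set B)) : Set B') = S' ∧
            S'.IsWeaklySolubleOfLength k) ∧
      (∀ n, ∀ a ∈ (S n : Set B), ∀ b ∈ (S n : Set B),
        SkewBrace.star a b ∈ (S (n + 1) : Set B)) ∧
      (SkewBrace.IsOmegaStable B → ∀ n, SkewBrace.IsDefinable (S n : Set B)) := by
  obtain ⟨S, hS, hS0, hstar⟩ := hB.exists_hulls C hC
  refine ⟨S, hS, hS0, ⟨hullType (C : Set B), ?_, fun B' _ f => ?_⟩, hstar, fun hω n => ?_⟩
  · rw [hB.realizations_hullType, ← (hS 0).1]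
    have : ElementaryEmbedding.refl Lang B '' (C : Set B) = (C.derived 0 : Set B) :=
      Set.image_id _
    rw [this]
  · obtain ⟨S', hS', hS'0, -⟩ := (hB.of_elementaryEmbedding f).exists_hulls (mapSubbrace f C)
      (mapSubbrace_isWeaklySolubleOfLength f hC)
    exact ⟨S' 0, (hB.realizations_hullType f _).trans (hS' 0).1, (hS' 0).1, (hS' 0).2, hS'0⟩
  · rw [← (hS n).1]
    exact hω.isDefinable_addHull _
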